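/- Let $G=(V,E)$ be an undirected graph with thresholds $t:V\to\{0,1,2,\dots\}$. For a target set $S\subseteq V$ put $\mathrm{Influenced}[S,0]=S$ and, for $\tau\ge 1$, $$\mathrm{Influenced}[S,\tau]=\mathrm{Influenced}[S,\tau-1]\cup\{u\in V:\ |N(u)\cap \mathrm{Influenced}[S,\tau-1]|\ge t(u)\}.$$ On unweighted graphs (unit vertex costs and unit edge influences), the $(\lambda,\beta)$-Maximally Influencing Set problem asks, given $G$, $t$, a latency bound $\lambda\ge 1$ and a budget $\beta\ge 1$, for a set $S\subseteq V$ with $|S|\le\beta$ for which $|\mathrm{Influenced}[S,\lambda]|$ is as large as possible. There is an algorithm (a program for a random access machine with unit-cost instructions, the graph being given by adjacency lists) which solves the $(\lambda,\beta)$-Maximally Influencing Set problem on every unweighted tree, with arbitrary thresholds, $\lambda\ge1$ and $\beta\ge1$, in time $$O\bigl(1+\min\{n\Delta^2\lambda^2\beta^3,\ n^2\lambda^2\beta^3\}\bigr),$$ where $n$ is the number of nodes and $\Delta$ the maximum degree of the tree. (For $n\ge2$ the summand $1$ is superfluous.) -/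

import Mathlib

/-! Influence diffusion and the Maximally Influencing Set problem, in general weighted directed
graphs. -/

open Classical in
/-- `influenced D w t S τ` is the set of vertices influenced within round `τ`, when the process
starts at the target set `S` in the directed graph `D` with arc influences `w` and
thresholds `t`. -/
noncomputable def influenced {V : Type*} [Fintype V] (D : Digraph V) (w : V → V → ℕ) (t : V → ℕ)
    (S : Finset V) : ℕ → Finset V
  | 0 => S
  | τ + 1 =>
      influenced D w t S τ ∪
        Finset.univ.filter fun u =>
          t u ≤ ∑ v ∈ (influenced D w t S τ).filter (fun v => D.Adj v u), w v u

/-- `S` is an optimal solution of the `(lam, β)`-MIS instance `(D, w, t, c)`: its cost is at most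
`β`, and no target set of cost at most `β` influences more vertices within round `lam`. -/
def IsMISSolution {V : Type*} [Fintype V] (D : Digraph V) (w : V → V → ℕ) (t c : V → ℕ)
    (lam β : ℕ) (S : Finset V) : Prop :=
  ∑ v ∈ S, c v ≤ β ∧
    ∀ S' : Finset V, ∑ v ∈ S', c v ≤ β →
      (influenced D w t S' lam).card ≤ (influenced D w t S lam).card

/-! A random access machine with unit-cost instructions, programmed with `if` and `while`. -/

namespace RAM

/-- A configuration: the registers (a program names only finitely many of them) and the
memory, which is addressed indirectly. All cells hold natural numbers. -/
structure State where
  reg : ℕ → ℕ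
  mem : ℕ → ℕ

/-- Set register `r` to `x`. -/
def State.setReg (s : State) (r x : ℕ) : State :=
  { s with reg := Function.update s.reg r x }

/-- Set the memory cell with address `a` to `x`. -/
def State.setMem (s : State) (a x : ℕ) : State :=
  { s with mem := Function.update s.mem a x }

/-- Programs. The arguments are register names, except for the constant `x` in `const r x`. -/
inductive Prog : Type
  | skip : Prog
  | const (r x : ℕ) : Prog
  | copy (r a : ℕ) : Prog
  | add (r a b : ℕ) : Prog
  | sub (r a b : ℕ) : Prog
  | load (r a : ℕ) : Prog
  | store (a r : ℕ) : Prog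
  | seq (P Q : Prog) : Prog
  | ifLt (a b : ℕ) (P Q : Prog) : Prog
  | whileLt (a b : ℕ) (P : Prog) : Prog

/-- `Runs P s k s'`: started in configuration `s`, the program `P` halts in configuration `s'`
after exactly `k` steps. Each elementary instruction and each evaluation of a test is one step. -/
inductive Runs : Prog → State → ℕ → State → Prop
  | skip (s : State) : Runs .skip s 1 s
  | const (r x : ℕ) (s : State) : Runs (.const r x) s 1 (s.setReg r x)
  | copy (r a : ℕ) (s : State) : Runs (.copy r a) s 1 (s.setReg r (s.reg a))
  | add (r a b : ℕ) (s : State) : Runs (.add r a b) s 1 (s.setReg r (s.reg a + s.reg b))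
  /-- Subtraction is truncated at `0`. -/
  | sub (r a b : ℕ) (s : State) : Runs (.sub r a b) s 1 (s.setReg r (s.reg a - s.reg b))
  | load (r a : ℕ) (s : State) : Runs (.load r a) s 1 (s.setReg r (s.mem (s.reg a)))
  | store (a r : ℕ) (s : State) : Runs (.store a r) s 1 (s.setMem (s.reg a) (s.reg r))
  | seq {P Q : Prog} {s s' s'' : State} {k l : ℕ} :
      Runs P s k s' → Runs Q s' l s'' → Runs (.seq P Q) s (k + l) s''
  | ifTrue {a b : ℕ} {P Q : Prog} {s s' : State} {k : ℕ} :
      s.reg a < s.reg b → Runs P s k s' → Runs (.ifLt a b P Q) s (k + 1) s'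
  | ifFalse {a b : ℕ} {P Q : Prog} {s s' : State} {k : ℕ} :
      ¬ s.reg a < s.reg b → Runs Q s k s' → Runs (.ifLt a b P Q) s (k + 1) s'
  | whileTrue {a b : ℕ} {P : Prog} {s s' s'' : State} {k l : ℕ} :
      s.reg a < s.reg b → Runs P s k s' → Runs (.whileLt a b P) s' l s'' →
      Runs (.whileLt a b P) s (k + l + 1) s''
  | whileFalse {a b : ℕ} {P : Prog} {s : State} :
      ¬ s.reg a < s.reg b → Runs (.whileLt a b P) s 1 s

/-- The initial configuration on input `x`: the input stands in the memory cells `0, 1, …`, and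
everything else is `0`. -/
def initial (x : List ℕ) : State where
  reg := fun _ => 0
  mem := fun i => x.getD i 0

end RAM

/-- `adj` is a system of adjacency lists for `G` (each list in an arbitrary order). -/
def IsAdjacencyLists {n : ℕ} (G : SimpleGraph (Fin n)) (adj : Fin n → List (Fin n)) : Prop :=
  ∀ v, (adj v).Nodup ∧ ∀ u, u ∈ adj v ↔ G.Adj v u

/-- The input for an unweighted instance on the vertices `0, …, n - 1`: the numbers `n`, `lam`
and `β`, then the `n` thresholds, then for each vertex its degree followed by its neighbours. -/
def encodeInstance {n : ℕ} (lam β : ℕ) (t : Fin n → ℕ) (adj : Fin n → List (Fin n)) : List ℕ :=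
  [n, lam, β] ++ List.ofFn t ++
    (List.ofFn adj).flatMap fun l => l.length :: l.map fun u => (u : ℕ)

/-!
The tree is solved by dynamic programming over *certificates*. A certificate gives each vertex a
label in `0, …, lam + 1`; the label `0` puts the vertex into the target set, a label `a` with
`1 ≤ a ≤ lam` is a promise that the vertex is influenced within round `a`, to be backed by as many
neighbours with smaller labels as the threshold asks for, and the label `lam + 1` promises nothing.
Promises are kept (`Certificate.mem_influenced`), and the true rounds of influence form a
certificate (`certificate_firstRound`). So the largest number of vertices that a target set of size
`β` influences within `lam` rounds is the largest number of labels at most `lam` in a certificate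
with at most `β` labels `0`. No upper bound on labels is needed, and this keeps the recursion short.

For a connected part `X` of the tree with distinguished vertex `p`, a table holds the best
certificate on `X` for each label `a` of `p`, each number `r` of helpers promised to `p` from
outside, and each budget `b`. Joining `X` and a second part `Y` along the only edge `pc` between
them, one has to choose the label `a'` of `c` and the share of the budget that goes to `Y`; the edge
then yields a helper for `p` if `a' < a`, and for `c` if `a < a'` (`certifiedWeights_union`).
All edges are contracted in this way, in the reverse order of a breadth-first search from the
vertex `0`, in which each vertex but the first has exactly one earlier neighbour (`Search.eq_par`).
A table has `(lam + 2) (Δ + 2) (β + 1)` cells, where `Δ` is the maximum degree, and each cell of a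
joined table takes `O(lam β)` steps, so that the whole takes `O(n Δ lam² β²)` steps
(`RAM.wp_mergeTables`, `RAM.time_le`). As `Δ ≤ n` and `Δ ≤ Δ²`, this is within both bounds.

No record of the choices is kept. Instead, the objective function is packed into one natural number:
a certificate weighs `n + 2 ^ n * g + ∑ 2 ^ u`, where `g` is the number of labels at most `lam` and
`u` runs through the target set (`packedWeight`). The weight is a sum over the vertices, its maximum
maximizes `g`, and its lower binary digits show an optimal target set (`exists_solution_of_max`).
The machine allows this, since its cells hold arbitrary natural numbers.

The program is verified phase by phase, with a total correctness calculus that keeps track of the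
number of steps (`RAM.Wp`).
-/

/-! ### Total correctness with step counts -/

namespace RAM

@[simp] theorem State.setReg_reg (s : State) (r x q : ℕ) :
    (s.setReg r x).reg q = if q = r then x else s.reg q := by
  simp [State.setReg, Function.update_apply]

@[simp] theorem State.setReg_mem (s : State) (r x : ℕ) : (s.setReg r x).mem = s.mem := rfl

@[simp] theorem State.setMem_reg (s : State) (a x : ℕ) : (s.setMem a x).reg = s.reg := rfl

@[simp] theorem State.setMem_mem (s : State) (a x q : ℕ) :
    (s.setMem a x).mem q = if q = a then x else s.mem q := by
  simp [State.setMem, Function.update_apply]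

/-- Total correctness with running time: `P`, started in `s`, halts, and the number of steps and
the final configuration satisfy `Q`. -/
def Wp (P : Prog) (s : State) (Q : ℕ → State → Prop) : Prop :=
  ∃ k s', Runs P s k s' ∧ Q k s'

/-- The registers that a program may write. -/
def Prog.writes : Prog → List ℕ
  | .skip => []
  | .const r _ => [r]
  | .copy r _ => [r]
  | .add r _ _ => [r]
  | .sub r _ _ => [r]
  | .load r _ => [r]
  | .store _ _ => []
  | .seq P Q => P.writes ++ Q.writes
  | .ifLt _ _ P Q => P.writes ++ Q.writes
  | .whileLt _ _ P => P.writes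

/-- The registers that `P` does not write agree in `s` and `s'`. -/
def Frame (P : Prog) (s s' : State) : Prop :=
  ∀ r, r ∉ P.writes → s'.reg r = s.reg r

theorem Runs.frame {P : Prog} {s s' : State} {k : ℕ} (h : Runs P s k s') : Frame P s s' := by
  induction h with
  | seq _ _ ih1 ih2 =>
    intro r hr
    simp only [Prog.writes, List.mem_append, not_or] at hr
    rw [ih2 r hr.2, ih1 r hr.1]
  | ifTrue _ _ ih =>
    intro r hr
    simp only [Prog.writes, List.mem_append, not_or] at hr
    exact ih r hr.1
  | ifFalse _ _ ih =>
    intro r hr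
    simp only [Prog.writes, List.mem_append, not_or] at hr
    exact ih r hr.2
  | whileTrue _ _ _ ih1 ih2 =>
    intro r hr
    rw [ih2 r hr, ih1 r hr]
  | skip | store | whileFalse => intro r _; rfl
  | _ =>
    intro r hr
    simp_all [Prog.writes]

/-- The rule of consequence, with the frame of the program at hand. -/
theorem Wp.mono {P : Prog} {s : State} {Q R : ℕ → State → Prop} (h : Wp P s Q)
    (H : ∀ k s', Frame P s s' → Q k s' → R k s') : Wp P s R := by
  obtain ⟨k, s', hr, hq⟩ := h
  exact ⟨k, s', hr, H k s' hr.frame hq⟩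

@[simp] theorem wp_skip {s : State} {Q : ℕ → State → Prop} : Wp .skip s Q ↔ Q 1 s :=
  ⟨fun ⟨_, _, h, q⟩ => by cases h; exact q, fun q => ⟨_, _, .skip s, q⟩⟩

@[simp] theorem wp_const {r x : ℕ} {s : State} {Q : ℕ → State → Prop} :
    Wp (.const r x) s Q ↔ Q 1 (s.setReg r x) :=
  ⟨fun ⟨_, _, h, q⟩ => by cases h; exact q, fun q => ⟨_, _, .const r x s, q⟩⟩

@[simp] theorem wp_copy {r a : ℕ} {s : State} {Q : ℕ → State → Prop} :
    Wp (.copy r a) s Q ↔ Q 1 (s.setReg r (s.reg a)) :=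
  ⟨fun ⟨_, _, h, q⟩ => by cases h; exact q, fun q => ⟨_, _, .copy r a s, q⟩⟩

@[simp] theorem wp_add {r a b : ℕ} {s : State} {Q : ℕ → State → Prop} :
    Wp (.add r a b) s Q ↔ Q 1 (s.setReg r (s.reg a + s.reg b)) :=
  ⟨fun ⟨_, _, h, q⟩ => by cases h; exact q, fun q => ⟨_, _, .add r a b s, q⟩⟩

@[simp] theorem wp_sub {r a b : ℕ} {s : State} {Q : ℕ → State → Prop} :
    Wp (.sub r a b) s Q ↔ Q 1 (s.setReg r (s.reg a - s.reg b)) :=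
  ⟨fun ⟨_, _, h, q⟩ => by cases h; exact q, fun q => ⟨_, _, .sub r a b s, q⟩⟩

@[simp] theorem wp_load {r a : ℕ} {s : State} {Q : ℕ → State → Prop} :
    Wp (.load r a) s Q ↔ Q 1 (s.setReg r (s.mem (s.reg a))) :=
  ⟨fun ⟨_, _, h, q⟩ => by cases h; exact q, fun q => ⟨_, _, .load r a s, q⟩⟩

@[simp] theorem wp_store {a r : ℕ} {s : State} {Q : ℕ → State → Prop} :
    Wp (.store a r) s Q ↔ Q 1 (s.setMem (s.reg a) (s.reg r)) :=
  ⟨fun ⟨_, _, h, q⟩ => by cases h; exact q, fun q => ⟨_, _, .store a r s, q⟩⟩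

@[simp] theorem wp_seq {P₁ P₂ : Prog} {s : State} {Q : ℕ → State → Prop} :
    Wp (.seq P₁ P₂) s Q ↔ Wp P₁ s fun k s' => Wp P₂ s' fun l s'' => Q (k + l) s'' := by
  constructor
  · rintro ⟨_, _, h, q⟩
    cases h with
    | seq h1 h2 => exact ⟨_, _, h1, _, _, h2, q⟩
  · rintro ⟨_, _, h1, _, _, h2, q⟩
    exact ⟨_, _, .seq h1 h2, q⟩

@[simp] theorem wp_ifLt {a b : ℕ} {P₁ P₂ : Prog} {s : State} {Q : ℕ → State → Prop} :
    Wp (.ifLt a b P₁ P₂) s Q ↔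
      if s.reg a < s.reg b then Wp P₁ s fun k s' => Q (k + 1) s'
      else Wp P₂ s fun k s' => Q (k + 1) s' := by
  split_ifs with hlt
  · constructor
    · rintro ⟨_, _, h, q⟩
      cases h with
      | ifTrue _ h => exact ⟨_, _, h, q⟩
      | ifFalse h' _ => exact absurd hlt h'
    · rintro ⟨_, _, h, q⟩
      exact ⟨_, _, .ifTrue hlt h, q⟩
  · constructor
    · rintro ⟨_, _, h, q⟩
      cases h with
      | ifTrue h' _ => exact absurd h' hlt
      | ifFalse _ h => exact ⟨_, _, h, q⟩
    · rintro ⟨_, _, h, q⟩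
      exact ⟨_, _, .ifFalse hlt h, q⟩

/-- The loop rule: a loop whose guard and body take at most `T` steps per round and which ends after
exactly `N` rounds, with the invariant `I`. -/
theorem wp_whileLt {a b : ℕ} {P : Prog} {s : State} (N T : ℕ) (I : ℕ → State → Prop)
    (h0 : I 0 s)
    (hc : ∀ j s', j ≤ N → Frame P s s' → I j s' → (s'.reg a < s'.reg b ↔ j < N))
    (hs : ∀ j s', j < N → Frame P s s' → I j s' → Wp P s' fun k s'' => k + 1 ≤ T ∧ I (j + 1) s'') :
    Wp (.whileLt a b P) s fun k s' => k ≤ N * T + 1 ∧ Frame P s s' ∧ I N s' := by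
  suffices H : ∀ i j s', i + j = N → Frame P s s' → I j s' →
      Wp (.whileLt a b P) s' fun k s'' => k ≤ i * T + 1 ∧ Frame P s s'' ∧ I N s'' from
    H N 0 s rfl (fun _ _ => rfl) h0
  intro i
  induction i with
  | zero =>
    intro j s' hj hf hI
    have : j = N := by omega
    subst this
    refine ⟨1, s', .whileFalse ?_, by omega, hf, hI⟩
    rw [hc j s' le_rfl hf hI]
    omega
  | succ i ih =>
    intro j s' hj hf hI
    obtain ⟨k, s1, hr, hk, hI1⟩ := hs j s' (by omega) hf hI
    have hf1 : Frame P s s1 := fun r hr' => by rw [hr.frame r hr', hf r hr']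
    obtain ⟨l, s2, hr2, hl, hI2⟩ := ih (j + 1) s1 (by omega) hf1 hI1
    refine ⟨_, s2, .whileTrue ((hc j s' (by omega) hf hI).2 (by omega)) hr hr2, ?_, hI2⟩
    rw [Nat.succ_mul]
    omega

/-- Sequential composition of a list of programs. -/
def block : List Prog → Prog
  | [] => .skip
  | P :: l => .seq P (block l)

@[simp] theorem wp_block_nil {s : State} {Q : ℕ → State → Prop} : Wp (block []) s Q ↔ Q 1 s :=
  wp_skip

@[simp] theorem wp_block_cons {P : Prog} {l : List Prog} {s : State} {Q : ℕ → State → Prop} :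
    Wp (block (P :: l)) s Q ↔ Wp P s fun k s' => Wp (block l) s' fun m s'' => Q (k + m) s'' :=
  wp_seq

end RAM

/-! ### Certificates -/

/-- `m` is the maximum of `A`, or `0` if `A` is empty. (A set without positive elements may also
be given the value `0`.) -/
def IsMaxOrZero (A : Set ℕ) (m : ℕ) : Prop :=
  (∀ x ∈ A, x ≤ m) ∧ (m = 0 ∨ m ∈ A)

theorem IsMaxOrZero.max {A B : Set ℕ} {x y : ℕ} (hA : IsMaxOrZero A x) (hB : IsMaxOrZero B y) :
    IsMaxOrZero (A ∪ B) (max x y) := by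
  refine ⟨?_, ?_⟩
  · rintro z (hz | hz)
    · exact (hA.1 z hz).trans (le_max_left _ _)
    · exact (hB.1 z hz).trans (le_max_right _ _)
  · rcases max_choice x y with h | h
    · rw [h]
      exact hA.2.imp id fun h => Or.inl h
    · rw [h]
      exact hB.2.imp id fun h => Or.inr h

/-- The maximum over a family of sumsets is found from the maxima of the summands. -/
theorem IsMaxOrZero.of_sums {K N : ℕ} {A B : ℕ → ℕ → Set ℕ} {f g : ℕ → ℕ → ℕ} {M : ℕ}
    (hA : ∀ i j, ∀ x ∈ A i j, 0 < x) (hB : ∀ i j, ∀ x ∈ B i j, 0 < x)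
    (hf : ∀ i ≤ K, ∀ j ≤ N, IsMaxOrZero (A i j) (f i j))
    (hg : ∀ i ≤ K, ∀ j ≤ N, IsMaxOrZero (B i j) (g i j))
    (hM : IsMaxOrZero {m | ∃ i ≤ K, ∃ j ≤ N, 0 < f i j ∧ 0 < g i j ∧ f i j + g i j = m} M) :
    IsMaxOrZero {m | ∃ i ≤ K, ∃ j ≤ N, ∃ x ∈ A i j, ∃ y ∈ B i j, x + y = m} M := by
  constructor
  · rintro _ ⟨i, hi, j, hj, x, hx, y, hy, rfl⟩
    have hx0 := hA i j x hx
    have hy0 := hB i j y hy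
    have hx1 := (hf i hi j hj).1 x hx
    have hy1 := (hg i hi j hj).1 y hy
    exact (add_le_add hx1 hy1).trans
      (hM.1 _ ⟨i, hi, j, hj, hx0.trans_le hx1, hy0.trans_le hy1, rfl⟩)
  · refine hM.2.imp id ?_
    rintro ⟨i, hi, j, hj, hf0, hg0, rfl⟩
    exact ⟨i, hi, j, hj, _, (hf i hi j hj).2.resolve_left hf0.ne', _,
      (hg i hi j hj).2.resolve_left hg0.ne', rfl⟩

open Classical in
/-- `ℓ` is a certificate on the part `X` of the graph with distinguished vertex `p`: a label
`ℓ u ≤ lam` promises that `u` is influenced within round `ℓ u`, the label `lam + 1` promises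
nothing, and the label `0` puts `u` into the target set. Each promise is backed by the neighbours
in `X` with smaller labels, and at `p` also by `r` helpers from outside. The label of `p` is `a`,
and at most `b` vertices are in the target set. -/
structure Certificate {n : ℕ} (G : SimpleGraph (Fin n)) (t : Fin n → ℕ) (lam : ℕ)
    (X : Finset (Fin n)) (p : Fin n) (a r b : ℕ) (ℓ : Fin n → ℕ) : Prop where
  root : ℓ p = a
  le : ∀ u ∈ X, ℓ u ≤ lam + 1
  backed : ∀ u ∈ X, 0 < ℓ u → ℓ u < lam + 1 →
    t u ≤ (X.filter fun x => G.Adj u x ∧ ℓ x < ℓ u).card + if u = p then r else 0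
  cost : (X.filter fun u => ℓ u = 0).card ≤ b

/-- The weight of a vertex `v` with label `a`. Sums of these weights over all vertices encode, in
binary, the number of vertices with a label at most `lam` (from the digit `n` on) and the set of
vertices with label `0` (in the digits below `n`), after subtraction of the number of vertices. The
summand `1` makes every weight positive, so that `0` can stand for the absence of a certificate. -/
def packedWeight (n lam v a : ℕ) : ℕ :=
  1 + (if a < lam + 1 then 2 ^ n else 0) + if a = 0 then 2 ^ v else 0

/-- The total weights of the certificates with the given parameters. -/
def certifiedWeights {n : ℕ} (G : SimpleGraph (Fin n)) (t : Fin n → ℕ) (lam : ℕ)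
    (X : Finset (Fin n)) (p : Fin n) (a r b : ℕ) : Set ℕ :=
  {m | ∃ ℓ, Certificate G t lam X p a r b ℓ ∧ ∑ u ∈ X, packedWeight n lam u (ℓ u) = m}

theorem packedWeight_pos (n lam v a : ℕ) : 0 < packedWeight n lam v a := by
  unfold packedWeight; omega

section

variable {n : ℕ} {G : SimpleGraph (Fin n)} {t : Fin n → ℕ} {lam : ℕ}

theorem pos_of_mem_certifiedWeights {X : Finset (Fin n)} {p : Fin n} {a r b m : ℕ} (hp : p ∈ X)
    (h : m ∈ certifiedWeights G t lam X p a r b) : 0 < m := by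
  obtain ⟨ℓ, -, rfl⟩ := h
  exact Finset.sum_pos (fun u _ => packedWeight_pos n lam u _) ⟨p, hp⟩

theorem certifiedWeights_singleton (v : Fin n) {a : ℕ} (ha : a ≤ lam + 1) (r b : ℕ) :
    certifiedWeights G t lam {v} v a r b =
      {m | (0 < a → a < lam + 1 → t v ≤ r) ∧ (a = 0 → 1 ≤ b) ∧ m = packedWeight n lam v a} := by
  ext m
  constructor
  · rintro ⟨ℓ, h, rfl⟩
    have hr := h.root
    subst hr
    refine ⟨fun h1 h2 => ?_, fun h0 => ?_, by simp⟩
    · have := h.backed v (by simp) h1 h2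
      simpa [Finset.filter_singleton] using this
    · have := h.cost
      rw [Finset.filter_singleton, if_pos h0] at this
      simpa using this
  · rintro ⟨h1, h2, rfl⟩
    refine ⟨fun _ => a, ⟨rfl, fun _ _ => ha, ?_, ?_⟩, by simp⟩
    · intro u hu h3 h4
      rw [Finset.mem_singleton] at hu
      subst hu
      simpa using h1 h3 h4
    · by_cases h0 : a = 0
      · simpa [h0, Finset.filter_singleton] using h2 h0
      · simp [h0]

/-- Joining two parts of the graph along the only edge `pc` between them. The part of `p` receives
one more helper if `c` has the smaller label, the part of `c` if `p` has the smaller label. -/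
theorem certifiedWeights_union {X Y : Finset (Fin n)} {p c : Fin n} (hp : p ∈ X) (hc : c ∈ Y)
    (hd : Disjoint X Y) (hadj : ∀ x ∈ X, ∀ y ∈ Y, G.Adj x y ↔ x = p ∧ y = c) (a r b : ℕ) :
    certifiedWeights G t lam (X ∪ Y) p a r b =
      {m | ∃ a' ≤ lam + 1, ∃ b' ≤ b,
        ∃ x ∈ certifiedWeights G t lam X p a (r + if a' < a then 1 else 0) (b - b'),
        ∃ y ∈ certifiedWeights G t lam Y c a' (if a < a' then 1 else 0) b', x + y = m} := by
  classical
  have hXY : ∀ x ∈ X, x ∉ Y := fun x hx hy => Finset.disjoint_left.1 hd hx hy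
  -- the helpers of `u` on the other side
  have cardY : ∀ (ℓ : Fin n → ℕ) (u : Fin n), u ∈ X →
      (Y.filter fun x => G.Adj u x ∧ ℓ x < ℓ u).card =
        if u = p then (if ℓ c < ℓ p then 1 else 0) else 0 := by
    intro ℓ u hu
    by_cases hup : u = p
    · subst hup
      rw [if_pos rfl]
      have : (Y.filter fun x => G.Adj u x ∧ ℓ x < ℓ u) = if ℓ c < ℓ u then {c} else ∅ := by
        ext x
        simp only [Finset.mem_filter]
        split_ifs with h
        · rw [Finset.mem_singleton]
          constructor
          · rintro ⟨h1, h2, h3⟩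
            exact ((hadj u hu x h1).1 h2).2
          · rintro rfl
            exact ⟨hc, (hadj u hu x hc).2 ⟨rfl, rfl⟩, h⟩
        · simp only [Finset.notMem_empty, iff_false]
          rintro ⟨h1, h2, h3⟩
          rw [((hadj u hu x h1).1 h2).2] at h3
          exact h h3
      rw [this]
      split_ifs <;> simp
    · rw [if_neg hup, Finset.card_eq_zero, Finset.filter_eq_empty_iff]
      rintro x hx ⟨h2, -⟩
      exact hup ((hadj u hu x hx).1 h2).1
  have cardX : ∀ (ℓ : Fin n → ℕ) (u : Fin n), u ∈ Y →
      (X.filter fun x => G.Adj u x ∧ ℓ x < ℓ u).card =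
        if u = c then (if ℓ p < ℓ c then 1 else 0) else 0 := by
    intro ℓ u hu
    by_cases huc : u = c
    · subst huc
      rw [if_pos rfl]
      have : (X.filter fun x => G.Adj u x ∧ ℓ x < ℓ u) = if ℓ p < ℓ u then {p} else ∅ := by
        ext x
        simp only [Finset.mem_filter]
        split_ifs with h
        · rw [Finset.mem_singleton]
          constructor
          · rintro ⟨h1, h2, h3⟩
            exact ((hadj x h1 u hu).1 h2.symm).1
          · rintro rfl
            exact ⟨hp, ((hadj x hp u hu).2 ⟨rfl, rfl⟩).symm, h⟩
        · simp only [Finset.notMem_empty, iff_false]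
          rintro ⟨h1, h2, h3⟩
          rw [((hadj x h1 u hu).1 h2.symm).1] at h3
          exact h h3
      rw [this]
      split_ifs <;> simp
    · rw [if_neg huc, Finset.card_eq_zero, Finset.filter_eq_empty_iff]
      rintro x hx ⟨h2, -⟩
      exact huc ((hadj x hx u hu).1 h2.symm).2
  have cardU : ∀ (q : Fin n → Prop) [DecidablePred q], ((X ∪ Y).filter q).card
      = (X.filter q).card + (Y.filter q).card := by
    intro q _
    rw [Finset.filter_union, Finset.card_union_of_disjoint
      (Finset.disjoint_filter_filter hd)]
  ext m
  constructor
  · rintro ⟨ℓ, h, rfl⟩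
    have hr := h.root
    subst hr
    have hcost := h.cost
    rw [cardU] at hcost
    refine ⟨ℓ c, h.le c (Finset.mem_union_right _ hc), (Y.filter fun u => ℓ u = 0).card,
      by omega, _, ⟨ℓ, ⟨rfl, fun u hu => h.le u (Finset.mem_union_left _ hu), ?_, by omega⟩, rfl⟩,
      _, ⟨ℓ, ⟨rfl, fun u hu => h.le u (Finset.mem_union_right _ hu), ?_, le_rfl⟩, rfl⟩,
      (Finset.sum_union hd).symm⟩
    · intro u hu h1 h2
      have := h.backed u (Finset.mem_union_left _ hu) h1 h2
      rw [cardU, cardY ℓ u hu] at this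
      split_ifs at this ⊢ <;> omega
    · intro u hu h1 h2
      have := h.backed u (Finset.mem_union_right _ hu) h1 h2
      have hup : u ≠ p := fun e => hXY p hp (e ▸ hu)
      rw [cardU, cardX ℓ u hu, if_neg hup] at this
      split_ifs at this ⊢ <;> omega
  · rintro ⟨a', ha', b', hb', _, ⟨ℓ₁, h1, rfl⟩, _, ⟨ℓ₂, h2, rfl⟩, rfl⟩
    set ℓ : Fin n → ℕ := fun u => if u ∈ Y then ℓ₂ u else ℓ₁ u with hℓ
    have e1 : ∀ u ∈ X, ℓ u = ℓ₁ u := fun u hu => if_neg (hXY u hu)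
    have e2 : ∀ u ∈ Y, ℓ u = ℓ₂ u := fun u hu => if_pos hu
    have hlp : ℓ p = a := (e1 p hp).trans h1.root
    have hlc : ℓ c = a' := (e2 c hc).trans h2.root
    refine ⟨ℓ, ⟨hlp, ?_, ?_, ?_⟩, ?_⟩
    · intro u hu
      rcases Finset.mem_union.1 hu with hu | hu
      · rw [e1 u hu]; exact h1.le u hu
      · rw [e2 u hu]; exact h2.le u hu
    · intro u hu hu1 hu2
      rcases Finset.mem_union.1 hu with hu | hu
      · rw [cardU, cardY ℓ u hu, hlp, hlc]
        have := h1.backed u hu (e1 u hu ▸ hu1) (e1 u hu ▸ hu2)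
        have e : (X.filter fun x => G.Adj u x ∧ ℓ x < ℓ u) =
            X.filter fun x => G.Adj u x ∧ ℓ₁ x < ℓ₁ u :=
          Finset.filter_congr fun x hx => by rw [e1 x hx, e1 u hu]
        rw [e]
        split_ifs at this ⊢ <;> omega
      · rw [cardU, cardX ℓ u hu, hlp, hlc]
        have := h2.backed u hu (e2 u hu ▸ hu1) (e2 u hu ▸ hu2)
        have e : (Y.filter fun x => G.Adj u x ∧ ℓ x < ℓ u) =
            Y.filter fun x => G.Adj u x ∧ ℓ₂ x < ℓ₂ u :=
          Finset.filter_congr fun x hx => by rw [e2 x hx, e2 u hu]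
        rw [e]
        split_ifs at this ⊢ <;> omega
    · rw [cardU]
      have e : (X.filter fun u => ℓ u = 0) = X.filter fun u => ℓ₁ u = 0 :=
        Finset.filter_congr fun x hx => by rw [e1 x hx]
      have e' : (Y.filter fun u => ℓ u = 0) = Y.filter fun u => ℓ₂ u = 0 :=
        Finset.filter_congr fun x hx => by rw [e2 x hx]
      have := h1.cost
      have := h2.cost
      rw [e, e']
      omega
    · rw [Finset.sum_union hd, Finset.sum_congr rfl fun u hu => by rw [e1 u hu],
        Finset.sum_congr (s₁ := Y) rfl fun u hu => by rw [e2 u hu]]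

open Classical in
theorem influenced_tree_succ (S : Finset (Fin n)) (τ : ℕ) (u : Fin n) :
    u ∈ influenced (Digraph.mk G.Adj) (fun _ _ => 1) t S (τ + 1) ↔
      u ∈ influenced (Digraph.mk G.Adj) (fun _ _ => 1) t S τ ∨
      t u ≤ ((influenced (Digraph.mk G.Adj) (fun _ _ => 1) t S τ).filter
        fun v => G.Adj u v).card := by
  simp [influenced, G.adj_comm u]

theorem influenced_mono (S : Finset (Fin n)) : Monotone fun τ =>
    influenced (Digraph.mk G.Adj) (fun _ _ => 1) t S τ :=
  monotone_nat_of_le_succ fun τ u hu => (influenced_tree_succ S τ u).2 (Or.inl hu)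

/-- A certificate keeps its promises. -/
theorem Certificate.mem_influenced {p : Fin n} {a b : ℕ} {ℓ : Fin n → ℕ}
    (h : Certificate G t lam Finset.univ p a 0 b ℓ) (τ : ℕ) :
    ∀ u, ℓ u ≤ τ → τ ≤ lam →
    u ∈ influenced (Digraph.mk G.Adj) (fun _ _ => 1) t (Finset.univ.filter fun v => ℓ v = 0) τ := by
  classical
  induction τ with
  | zero => intro u hu _; simpa [influenced] using hu
  | succ τ ih =>
    intro u hu hτ
    rw [influenced_tree_succ]
    by_cases hlt : ℓ u ≤ τ
    · exact Or.inl (ih u hlt (by omega))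
    · right
      have := h.backed u (Finset.mem_univ u) (by omega) (by omega)
      rw [ite_self, add_zero] at this
      refine this.trans (Finset.card_le_card fun x hx => ?_)
      simp only [Finset.mem_filter, Finset.mem_univ, true_and] at hx ⊢
      exact ⟨ih x (by omega) (by omega), hx.1⟩

open Classical in
/-- The first round (up to `lam`) in which `u` is influenced, or `lam + 1`. -/
noncomputable def firstRound (G : SimpleGraph (Fin n)) (t : Fin n → ℕ) (lam : ℕ)
    (S : Finset (Fin n)) (u : Fin n) : ℕ :=
  if h : ∃ τ, u ∈ influenced (Digraph.mk G.Adj) (fun _ _ => 1) t S τ then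
    min (Nat.find h) (lam + 1) else lam + 1

theorem firstRound_le_iff (S : Finset (Fin n)) (u : Fin n) {τ : ℕ} (hτ : τ ≤ lam) :
    firstRound G t lam S u ≤ τ ↔
      u ∈ influenced (Digraph.mk G.Adj) (fun _ _ => 1) t S τ := by
  classical
  unfold firstRound
  split_ifs with h
  · constructor
    · intro h'
      have : Nat.find h ≤ τ := by omega
      exact influenced_mono S this (Nat.find_spec h)
    · intro h'
      have := Nat.find_min' h h'
      omega
  · constructor
    · intro h'; omega
    · intro h'; exact absurd ⟨τ, h'⟩ h

theorem certificate_firstRound (S : Finset (Fin n)) {b : ℕ} (hS : S.card ≤ b) (p : Fin n) :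
    Certificate G t lam Finset.univ p (firstRound G t lam S p) 0 b (firstRound G t lam S) := by
  classical
  have h0 : ∀ u, firstRound G t lam S u = 0 ↔ u ∈ S := by
    intro u
    rw [← Nat.le_zero, firstRound_le_iff S u (Nat.zero_le _)]
    simp [influenced]
  refine ⟨rfl, fun u _ => ?_, fun u _ h1 h2 => ?_, ?_⟩
  · unfold firstRound
    split_ifs <;> omega
  · obtain ⟨τ, hτ⟩ : ∃ τ, firstRound G t lam S u = τ + 1 := ⟨_, (Nat.succ_pred_eq_of_pos h1).symm⟩
    have h3 := (firstRound_le_iff (G := G) (t := t) (lam := lam) S u (τ := τ + 1) (by omega)).1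
      hτ.le
    have h4 := (firstRound_le_iff (G := G) (t := t) (lam := lam) S u (τ := τ) (by omega)).not.1
      (by omega)
    rw [influenced_tree_succ] at h3
    rw [ite_self, add_zero]
    refine (h3.resolve_left h4).trans (Finset.card_le_card fun x hx => ?_)
    simp only [Finset.mem_filter, Finset.mem_univ, true_and] at hx ⊢
    exact ⟨hx.2, hτ ▸ Nat.lt_succ_of_le ((firstRound_le_iff S x (by omega)).2 hx.1)⟩
  · simpa [h0] using hS

theorem sum_two_pow_lt {A : Finset (Fin n)} {v : ℕ} (hA : ∀ u ∈ A, (u : ℕ) < v) :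
    ∑ u ∈ A, 2 ^ (u : ℕ) < 2 ^ v := by
  have := Nat.geomSum_lt (m := 2) (n := v) (s := A.map Fin.valEmbedding) le_rfl (by
    intro k hk
    obtain ⟨x, hx, rfl⟩ := Finset.mem_map.1 hk
    exact hA x hx)
  simpa using this

theorem sum_packedWeight (ℓ : Fin n → ℕ) : ∑ u : Fin n, packedWeight n lam u (ℓ u) =
    n + 2 ^ n * (Finset.univ.filter fun u => ℓ u < lam + 1).card
      + ∑ u ∈ Finset.univ.filter (fun u => ℓ u = 0), 2 ^ (u : ℕ) := by
  simp only [packedWeight, Finset.sum_add_distrib, ← Finset.sum_filter]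
  simp [mul_comm]

/-- The binary digits of the maximum weight show an optimal target set. -/
theorem exists_solution_of_max {p : Fin n} {b M : ℕ}
    (hM : IsMaxOrZero {m | ∃ a ≤ lam + 1, m ∈ certifiedWeights G t lam Finset.univ p a 0 b} M) :
    ∃ (S : Finset (Fin n)) (g : ℕ), g ≤ n ∧ M = n + 2 ^ n * g + ∑ u ∈ S, 2 ^ (u : ℕ) ∧
      IsMISSolution (Digraph.mk G.Adj) (fun _ _ => 1) t (fun _ => 1) lam b S := by
  classical
  have key : ∀ S : Finset (Fin n), S.card ≤ b →
      ∑ u : Fin n, packedWeight n lam u (firstRound G t lam S u) ≤ M := fun S hS =>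
    hM.1 _ ⟨_, (certificate_firstRound S hS p).le p (Finset.mem_univ p), _,
      certificate_firstRound S hS p, rfl⟩
  have hM0 : M ≠ 0 := by
    intro h
    have h1 := key ∅ (by simp)
    have h2 := Finset.sum_pos (s := Finset.univ) (fun (u : Fin n) _ => packedWeight_pos n lam u (firstRound G t lam ∅ u))
      ⟨p, Finset.mem_univ p⟩
    omega
  obtain ⟨a, ha, ℓ, hℓ, hw⟩ := hM.2.resolve_left hM0
  refine ⟨Finset.univ.filter fun u => ℓ u = 0, (Finset.univ.filter fun u => ℓ u < lam + 1).card,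
    (Finset.card_le_univ _).trans (by simp), ?_, ?_, fun S' hS' => ?_⟩
  · rw [← hw, sum_packedWeight]
  · simpa using hℓ.cost
  · have h1 := key S' (by simpa using hS')
    rw [← hw, sum_packedWeight, sum_packedWeight] at h1
    have h2 := sum_two_pow_lt (A := Finset.univ.filter fun u => ℓ u = 0) fun u _ => u.2
    set g := (Finset.univ.filter fun u => ℓ u < lam + 1).card
    have h3 : (Finset.univ.filter fun u => firstRound G t lam S' u < lam + 1).card ≤ g := by
      by_contra hlt
      have : 2 ^ n * (g + 1) ≤
          2 ^ n * (Finset.univ.filter fun u => firstRound G t lam S' u < lam + 1).card :=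
        Nat.mul_le_mul_left _ (by omega)
      rw [mul_add] at this
      omega
    have h4 : influenced (Digraph.mk G.Adj) (fun _ _ => 1) t S' lam =
        Finset.univ.filter fun u => firstRound G t lam S' u < lam + 1 := by
      ext u
      simp [← firstRound_le_iff S' u le_rfl]
    rw [h4]
    refine h3.trans (Finset.card_le_card fun u hu => ?_)
    simp only [Finset.mem_filter, Finset.mem_univ, true_and] at hu
    exact hℓ.mem_influenced lam u (by omega) le_rfl

end

namespace RAM

/-! ### Registers and tables -/

/-! The registers below `17` are constant after the setup. `rFree` is the first free address above
the tables, and the registers from `rV` on serve the single phases. -/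

local notation "rZero" => (0 : ℕ)
local notation "rOne" => (1 : ℕ)
local notation "rN" => (2 : ℕ)
local notation "rLam" => (3 : ℕ)
local notation "rBeta" => (4 : ℕ)
local notation "rThr" => (5 : ℕ)
local notation "rNever" => (6 : ℕ)
local notation "rL" => (7 : ℕ)
local notation "rB" => (8 : ℕ)
local notation "rD" => (9 : ℕ)
local notation "rDB" => (10 : ℕ)
local notation "rW" => (11 : ℕ)
local notation "rOff" => (12 : ℕ)
local notation "rSeen" => (13 : ℕ)
local notation "rQueue" => (14 : ℕ)
local notation "rPar" => (15 : ℕ)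
local notation "rTab" => (16 : ℕ)
local notation "rFree" => (17 : ℕ)
local notation "rV" => (18 : ℕ)
local notation "rPow" => (19 : ℕ)
local notation "rTv" => (20 : ℕ)
local notation "rDelta" => (21 : ℕ)
local notation "rChild" => (22 : ℕ)
local notation "rI" => (23 : ℕ)
local notation "cA" => (24 : ℕ)
local notation "cR" => (25 : ℕ)
local notation "cB" => (26 : ℕ)
local notation "rBest" => (27 : ℕ)
local notation "rSrc" => (28 : ℕ)
local notation "rRow" => (29 : ℕ)
local notation "rAc" => (30 : ℕ)
local notation "rP" => (31 : ℕ)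
local notation "rQ" => (32 : ℕ)
local notation "rJ" => (33 : ℕ)
local notation "rJEnd" => (34 : ℕ)
local notation "rX" => (35 : ℕ)
local notation "rY" => (36 : ℕ)
local notation "rZ" => (37 : ℕ)
local notation "rTail" => (38 : ℕ)

/-- The registers below `17` hold the parameters of the instance, the strides of the tables and the
addresses of the arrays. -/
structure Env (n lam β D : ℕ) (s : State) : Prop where
  zero : s.reg rZero = 0
  one : s.reg rOne = 1
  N : s.reg rN = n
  lambda : s.reg rLam = lam
  beta : s.reg rBeta = β
  thr : s.reg rThr = 3
  never : s.reg rNever = lam + 1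
  L : s.reg rL = lam + 2
  B : s.reg rB = β + 1
  rows : s.reg rD = D
  stride : s.reg rDB = D * (β + 1)
  W : s.reg rW = 2 ^ n
  off : s.reg rOff = 4 * n + 4
  seen : s.reg rSeen = 5 * n + 4
  queue : s.reg rQueue = 6 * n + 4
  par : s.reg rPar = 7 * n + 4
  tab : s.reg rTab = 8 * n + 4

theorem Env.of_eq {n lam β D : ℕ} {s s' : State} (E : Env n lam β D s)
    (h : ∀ r < 17, s'.reg r = s.reg r) : Env n lam β D s' where
  zero := (h _ (by norm_num)).trans E.zero
  one := (h _ (by norm_num)).trans E.one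
  N := (h _ (by norm_num)).trans E.N
  lambda := (h _ (by norm_num)).trans E.lambda
  beta := (h _ (by norm_num)).trans E.beta
  thr := (h _ (by norm_num)).trans E.thr
  never := (h _ (by norm_num)).trans E.never
  L := (h _ (by norm_num)).trans E.L
  B := (h _ (by norm_num)).trans E.B
  rows := (h _ (by norm_num)).trans E.rows
  stride := (h _ (by norm_num)).trans E.stride
  W := (h _ (by norm_num)).trans E.W
  off := (h _ (by norm_num)).trans E.off
  seen := (h _ (by norm_num)).trans E.seen
  queue := (h _ (by norm_num)).trans E.queue
  par := (h _ (by norm_num)).trans E.par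
  tab := (h _ (by norm_num)).trans E.tab

/-- Write a table at the free part of the memory: for each label `a`, number of promised helpers
`r` and budget `b`, in this order, the value that `body` computes. -/
def fill (body : Prog) : Prog :=
  .seq (.const cA 0) <| .whileLt cA rL <| block
    [ .const cR 0,
      .whileLt cR rD <| block
        [ .const cB 0,
          .whileLt cB rB <| block
            [body, .store rFree rBest, .add rFree rFree rOne, .add cB cB rOne],
          .add cR cR rOne ],
      .add cA cA rOne ]

/-- The contents of the tables, cell by cell. -/
def cellValue (D β : ℕ) (f : ℕ → ℕ → ℕ → ℕ) (k : ℕ) : ℕ :=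
  f (k / (β + 1) / D) (k / (β + 1) % D) (k % (β + 1))

theorem cellValue_index {D β a r b : ℕ} (f : ℕ → ℕ → ℕ → ℕ) (hr : r < D) (hb : b ≤ β) :
    cellValue D β f ((a * D + r) * (β + 1) + b) = f a r b := by
  have h1 : ((a * D + r) * (β + 1) + b) / (β + 1) = a * D + r := by
    rw [mul_comm, Nat.mul_add_div (by omega), Nat.div_eq_of_lt (by omega), add_zero]
  have h2 : ((a * D + r) * (β + 1) + b) % (β + 1) = b := by
    rw [mul_comm, Nat.mul_add_mod, Nat.mod_eq_of_lt (by omega)]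
  have h3 : (a * D + r) / D = a := by
    rw [mul_comm, Nat.mul_add_div (by omega), Nat.div_eq_of_lt hr, add_zero]
  have h4 : (a * D + r) % D = r := by
    rw [mul_comm, Nat.mul_add_mod, Nat.mod_eq_of_lt hr]
  rw [cellValue, h1, h2, h3, h4]

/-- The first `k` cells of the table `f` have been written, since configuration `s`. -/
structure Filled (D β : ℕ) (f : ℕ → ℕ → ℕ → ℕ) (s : State) (k : ℕ) (s' : State) : Prop where
  free : s'.reg rFree = s.reg rFree + k
  old : ∀ x < s.reg rFree, s'.mem x = s.mem x
  new : ∀ i < k, s'.mem (s.reg rFree + i) = cellValue D β f i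

theorem wp_fill {n lam β D : ℕ} {body : Prog} {s : State} (E : Env n lam β D s)
    (f : ℕ → ℕ → ℕ → ℕ) (T : ℕ) (hw : ∀ r < 27, r ∉ body.writes)
    (hbody : ∀ a r b, a ≤ lam + 1 → r < D → b ≤ β → ∀ s' : State,
      (∀ q < 24, q ≠ rFree → s'.reg q = s.reg q) → s'.reg cA = a → s'.reg cR = r → s'.reg cB = b →
      s'.reg rFree = s.reg rFree + ((a * D + r) * (β + 1) + b) →
      (∀ x < s.reg rFree, s'.mem x = s.mem x) →
      Wp body s' fun k s'' => k ≤ T ∧ s''.reg rBest = f a r b ∧ s''.mem = s'.mem) :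
    Wp (fill body) s fun k s' =>
      k ≤ (lam + 2) * (D * ((β + 1) * (T + 5) + 6) + 6) + 3 ∧
      Filled D β f s ((lam + 2) * (D * (β + 1))) s' := by
  have hW : ∀ r, r < 24 → r ≠ rFree → r ∉ (fill body).writes := by
    intro r hr h1
    have := hw r (by omega)
    simp [fill, block, Prog.writes, this]
    omega
  have hW := fun r h h' hm => hW r h h' (List.mem_append_right [cA] hm)
  unfold fill
  simp only [wp_seq, wp_const]
  refine (wp_whileLt (lam + 2) (D * ((β + 1) * (T + 5) + 6) + 6)
    (fun a s' => s'.reg cA = a ∧ Filled D β f s (a * (D * (β + 1))) s')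
    ?_ ?_ ?_).mono ?_
  · refine ⟨by simp, ?_, ?_, ?_⟩ <;> simp
  · rintro a s1 - hf ⟨h1, -⟩
    rw [h1, hf rL (hW rL (by norm_num) (by norm_num))]
    simp [E.L]
  · rintro a s1 ha hf1 ⟨h1, hF1⟩
    have hf1' : ∀ q < 24, q ≠ rFree → s1.reg q = s.reg q := by
      intro q hq hq'
      rw [hf1 q (hW q hq hq')]
      simp; omega
    simp only [wp_block_cons, wp_const]
    refine (wp_whileLt D ((β + 1) * (T + 5) + 6)
      (fun r s' => s'.reg cA = a ∧ s'.reg cR = r ∧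
        (∀ q < 24, q ≠ rFree → s'.reg q = s.reg q) ∧
        Filled D β f s ((a * D + r) * (β + 1)) s') ?_ ?_ ?_).mono ?_
    · refine ⟨by simpa using h1, by simp, ?_, ?_, ?_, ?_⟩
      · intro q hq hq'
        rw [← hf1' q hq hq']
        simp; omega
      · simpa [mul_assoc] using hF1.free
      · simpa using hF1.old
      · simpa [mul_assoc] using hF1.new
    · rintro r s2 - - ⟨-, h2, h3, -⟩
      rw [h2, h3 rD (by norm_num) (by norm_num), E.rows]
    · rintro r s2 hr - ⟨h21, h22, h23, hF2⟩
      simp only [wp_block_cons, wp_const]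
      refine (wp_whileLt (β + 1) (T + 5)
        (fun b s' => s'.reg cA = a ∧ s'.reg cR = r ∧ s'.reg cB = b ∧
          (∀ q < 24, q ≠ rFree → s'.reg q = s.reg q) ∧
          Filled D β f s ((a * D + r) * (β + 1) + b) s') ?_ ?_ ?_).mono ?_
      · refine ⟨by simpa using h21, by simpa using h22, by simp, ?_, ?_, ?_, ?_⟩
        · intro q hq hq'
          rw [← h23 q hq hq']
          simp; omega
        · simpa using hF2.free
        · simpa using hF2.old
        · simpa using hF2.new
      · rintro b s3 - - ⟨-, -, h3, h4, -⟩
        rw [h3, h4 rB (by norm_num) (by norm_num), E.B]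
      · rintro b s3 hb - ⟨h31, h32, h33, h34, hF3⟩
        simp only [wp_block_cons]
        refine (hbody a r b (by omega) hr (by omega) s3 h34 h31 h32 h33 hF3.free hF3.old).mono ?_
        rintro k s4 hf4 ⟨hk, h41, h42⟩
        have e : ∀ q < 27, s4.reg q = s3.reg q := fun q hq => hf4 q (hw q hq)
        have eF := e rFree (by norm_num)
        have e1 : s4.reg rOne = 1 := by
          rw [e _ (by norm_num), h34 _ (by norm_num) (by norm_num), E.one]
        simp only [wp_store, wp_add, wp_block_nil, State.setReg_reg, State.setMem_reg]
        refine ⟨by omega, ?_, ?_, ?_, ?_, ?_, ?_, ?_⟩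
        · simp [e cA, h31]
        · simp [e cR, h32]
        · simp [e cB, h33, e1]
        · intro q hq hq'
          rw [← h34 q hq hq', ← e q (by omega)]
          rw [if_neg (by omega), if_neg hq']
        · simp [eF, hF3.free, e1, add_assoc]
        · intro x hx
          have : x ≠ s.reg rFree + ((a * D + r) * (β + 1) + b) := by omega
          simp [eF, hF3.free, h42, this, hF3.old x hx]
        · intro i hi
          by_cases hi' : i = (a * D + r) * (β + 1) + b
          · subst hi'
            simp [eF, hF3.free, h41, cellValue_index f hr (show b ≤ β by omega)]
          · simp [eF, hF3.free, h42, hi', hF3.new i (by omega)]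
      · rintro k s3 - ⟨hk, -, h31, h32, h33, h34, hF3⟩
        have e1 : s3.reg rOne = 1 := by rw [h34 _ (by norm_num) (by norm_num), E.one]
        simp only [wp_add, wp_block_nil]
        refine ⟨by omega, by simpa using h31, by simp [h32, e1], ?_, ?_, ?_, ?_⟩
        · intro q hq hq'
          rw [← h34 q hq hq']
          simp; omega
        · have := hF3.free
          simp only [State.setReg_reg]
          rw [if_neg (by norm_num), this]
          ring
        · simpa using hF3.old
        · intro i hi
          exact hF3.new i (by linarith)
    · rintro k s2 - ⟨hk, -, h21, h22, h23, hF2⟩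
      have e1 : s2.reg rOne = 1 := by rw [h23 _ (by norm_num) (by norm_num), E.one]
      simp only [wp_add, wp_block_nil]
      refine ⟨by omega, by simp [h21, e1], ?_, ?_, ?_⟩
      · have := hF2.free
        simp only [State.setReg_reg]
        rw [if_neg (by norm_num), this]
        ring
      · simpa using hF2.old
      · intro i hi
        exact hF2.new i (by linarith)
  · rintro k s1 - ⟨hk, -, -, hF⟩
    exact ⟨by omega, hF⟩

/-! ### Computing the cells of a table -/

/-- The weight of a single vertex with threshold `τ` as a part of its own. -/
def initialValue (n lam v τ a r b : ℕ) : ℕ :=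
  if (0 < a → a < lam + 1 → τ ≤ r) ∧ (a = 0 → 1 ≤ b) then packedWeight n lam v a else 0

/-- Computes `initialValue` for the current cell. -/
def initialCell : Prog :=
  .ifLt rZero cA
    (.ifLt cA rNever
      (.ifLt cR rTv (.const rBest 0) (.add rBest rW rOne))
      (.copy rBest rOne))
    (.ifLt rZero cB
      (block [.add rBest rW rPow, .add rBest rBest rOne])
      (.const rBest 0))

theorem wp_initialCell {n lam β D v τ a r b : ℕ} {s : State} (E : Env n lam β D s)
    (hτ : s.reg rTv = τ) (hv : s.reg rPow = 2 ^ v) (ha : s.reg cA = a) (hr : s.reg cR = r)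
    (hb : s.reg cB = b) (hal : a ≤ lam + 1) :
    Wp initialCell s fun k s' =>
      k ≤ 6 ∧ s'.reg rBest = initialValue n lam v τ a r b ∧ s'.mem = s.mem := by
  unfold initialCell initialValue packedWeight
  simp only [wp_ifLt, wp_block_cons, wp_block_nil, wp_const, wp_copy, wp_add, State.setReg_reg,
    State.setReg_mem, E.zero, E.one, E.W, E.never, hτ, hv, ha, hr, hb]
  by_cases h0 : 0 < a
  · have h0' : a ≠ 0 := by omega
    by_cases h1 : a < lam + 1
    · by_cases h2 : r < τ
      · have : ¬ τ ≤ r := by omega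
        simp [h0, h1, h2, h0']
      · have : τ ≤ r := by omega
        simp [h0, h1, h2, h0', this]; omega
    · simp [h0, h1, h0']
  · have h0' : a = 0 := by omega
    subst h0'
    by_cases h1 : 0 < b
    · have : 1 ≤ b := h1
      simp [h1, this]; omega
    · have : ¬ 1 ≤ b := by omega
      simp [h1, this]

/-- Addition of maximal weights, where `0` stands for the maximum of the empty set. -/
def combine (x y : ℕ) : ℕ := if 0 < x ∧ 0 < y then x + y else 0

/-- Raises `rBest` to the largest combination of a pair of cells, over all ways to split the
budget. -/
def splitLoop : Prog :=
  .whileLt rJ rJEnd <| block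
    [ .load rX rP, .load rY rQ,
      .ifLt rZero rX
        (.ifLt rZero rY
          (.seq (.add rZ rX rY) (.ifLt rBest rZ (.copy rBest rZ) .skip)) .skip) .skip,
      .sub rP rP rOne, .add rQ rQ rOne, .add rJ rJ rOne ]

theorem wp_splitLoop {p q b m : ℕ} {s : State} (h0 : s.reg rZero = 0) (h1 : s.reg rOne = 1)
    (hp : s.reg rP = p) (hq : s.reg rQ = q) (hj : s.reg rJ = 0) (he : s.reg rJEnd = b + 1)
    (hm : s.reg rBest = m) :
    Wp splitLoop s fun k s' => k ≤ (b + 1) * 12 + 1 ∧ s'.mem = s.mem ∧ s'.reg rBest =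
      max m ((Finset.range (b + 1)).sup fun j => combine (s.mem (p - j)) (s.mem (q + j))) := by
  unfold splitLoop
  refine (wp_whileLt (b + 1) 12 (fun j s' => s'.reg rJ = j ∧ s'.reg rP = p - j ∧
    s'.reg rQ = q + j ∧ s'.mem = s.mem ∧ s'.reg rBest =
      max m ((Finset.range j).sup fun j => combine (s.mem (p - j)) (s.mem (q + j))))
    ?_ ?_ ?_).mono ?_
  · simp [hp, hq, hj, hm]
  · rintro j s1 - hf ⟨h2, -⟩
    rw [h2, hf rJEnd (by decide), he]
  · rintro j s1 hj hf ⟨h2, h3, h4, h5, h6⟩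
    have f0 : s1.reg rZero = 0 := (hf rZero (by decide)).trans h0
    have f1 : s1.reg rOne = 1 := (hf rOne (by decide)).trans h1
    simp only [wp_ifLt, wp_block_cons, wp_block_nil, wp_seq, wp_skip, wp_copy, wp_add, wp_sub,
      wp_load, State.setReg_reg, State.setReg_mem, f0, f1, h2, h3, h4, h5, h6, Finset.range_add_one,
      Finset.sup_insert, ↓reduceIte, Nat.reduceEqDiff]
    set x := s.mem (p - j)
    set y := s.mem (q + j)
    set M := (Finset.range j).sup fun j => combine (s.mem (p - j)) (s.mem (q + j))
    have e1 : p - j - 1 = p - (j + 1) := by omega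
    have e2 : q + j + 1 = q + (j + 1) := by omega
    split_ifs with hx hy hlt
    · exact ⟨by norm_num, trivial, e1, e2, trivial, by rw [combine, if_pos ⟨hx, hy⟩]; omega⟩
    · exact ⟨by norm_num, trivial, e1, e2, trivial, by rw [combine, if_pos ⟨hx, hy⟩]; omega⟩
    · exact ⟨by norm_num, trivial, e1, e2, trivial, by
        rw [combine, if_neg fun h => hy h.2, Nat.zero_max]⟩
    · exact ⟨by norm_num, trivial, e1, e2, trivial, by
        rw [combine, if_neg fun h => hx h.1, Nat.zero_max]⟩
  · rintro k s1 - ⟨hk, -, -, -, -, h5, h6⟩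
    exact ⟨hk, h5, h6⟩

/-- The cell for label `a`, `r` promised helpers and budget `b` of the table at address `base`. -/
def cell (D β : ℕ) (mem : ℕ → ℕ) (base a r b : ℕ) : ℕ :=
  mem (base + ((a * D + r) * (β + 1) + b))

/-- The entries of the table of a part into which another part has been merged, in terms of the
tables `F` and `F'` of the two parts. -/
def mergeValue (lam : ℕ) (F F' : ℕ → ℕ → ℕ → ℕ) (a r b : ℕ) : ℕ :=
  (Finset.range (lam + 2)).sup fun a' => (Finset.range (b + 1)).sup fun j =>
    combine (F a (r + if a' < a then 1 else 0) (b - j)) (F' a' (if a < a' then 1 else 0) j)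

/-- Computes `mergeValue` for the current cell. The cell with the same parameters in the old table
of the parent lies `rDelta` before the one to be written. -/
def mergeCell : Prog := block
  [ .sub rSrc rFree rDelta, .add rJEnd cB rOne,
    .const rBest 0, .copy rRow rChild, .const rAc 0,
    .whileLt rAc rL <| block
      [ .copy rP rSrc, .copy rQ rRow,
        .ifLt rAc cA (.add rP rP rB) .skip,
        .ifLt cA rAc (.add rQ rQ rB) .skip,
        .const rJ 0, splitLoop,
        .add rRow rRow rDB, .add rAc rAc rOne ] ]

theorem wp_mergeCell {n lam β D a r b p c δ : ℕ} {s s₀ : State} (E : Env n lam β D s)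
    (hD : 2 ≤ D) (hδ : s.reg rDelta = δ) (hc : s.reg rChild = c) (ha : s.reg cA = a)
    (hb : s.reg cB = b) (hfree : s.reg rFree = s₀.reg rFree + ((a * D + r) * (β + 1) + b))
    (hp : p + δ = s₀.reg rFree)
    (hp' : p + ((lam + 2) * (D * (β + 1)) + (β + 1)) ≤ s₀.reg rFree)
    (hc' : c + (lam + 2) * (D * (β + 1)) ≤ s₀.reg rFree)
    (hmem : ∀ x < s₀.reg rFree, s.mem x = s₀.mem x)
    (hal : a ≤ lam + 1) (hr : r < D) (hbl : b ≤ β) :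
    Wp mergeCell s fun k s' => k ≤ (lam + 2) * ((β + 1) * 12 + 13) + 8 ∧
      s'.reg rBest = mergeValue lam (cell D β s₀.mem p) (cell D β s₀.mem c) a r b ∧
      s'.mem = s.mem := by
  have hsrc : s.reg rFree - δ = p + ((a * D + r) * (β + 1) + b) := by omega
  unfold mergeCell
  simp only [wp_block_cons, wp_block_nil, wp_const, wp_copy, wp_add, wp_sub]
  refine (wp_whileLt (lam + 2) ((β + 1) * 12 + 13) (fun i s' => s'.reg rAc = i ∧
    s'.reg rRow = c + i * (D * (β + 1)) ∧ s'.mem = s.mem ∧ s'.reg rBest =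
      (Finset.range i).sup fun a' => (Finset.range (b + 1)).sup fun j =>
        combine (cell D β s₀.mem p a (r + if a' < a then 1 else 0) (b - j))
          (cell D β s₀.mem c a' (if a < a' then 1 else 0) j)) ?_ ?_ ?_).mono ?_
  · simp [hc]
  · rintro i s1 - hf ⟨h1, -⟩
    rw [h1, hf rL (by decide)]
    simp [E.L]
  · rintro i s1 hi hf ⟨h1, h2, h3, h4⟩
    have f0 : s1.reg rZero = 0 := (hf rZero (by decide)).trans (by simp [E.zero])
    have f1 : s1.reg rOne = 1 := (hf rOne (by decide)).trans (by simp [E.one])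
    have f2 : s1.reg rB = β + 1 := (hf rB (by decide)).trans (by simp [E.B])
    have f3 : s1.reg rDB = D * (β + 1) := (hf rDB (by decide)).trans (by simp [E.stride])
    have f4 : s1.reg rSrc = p + ((a * D + r) * (β + 1) + b) :=
      (hf rSrc (by decide)).trans (by simp [hδ, hsrc])
    have f5 : s1.reg rJEnd = b + 1 := (hf rJEnd (by decide)).trans (by simp [hb, E.one])
    have f6 : s1.reg cA = a := (hf cA (by decide)).trans (by simp [ha])
    -- the two pointers after the tests
    have main : ∀ s2 : State, (∀ q, q ≠ rP → q ≠ rQ → q ≠ rJ → s2.reg q = s1.reg q) →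
        s2.mem = s1.mem → s2.reg rJ = 0 →
        s2.reg rP = p + ((a * D + r) * (β + 1) + b) + (if i < a then β + 1 else 0) →
        s2.reg rQ = c + i * (D * (β + 1)) + (if a < i then β + 1 else 0) →
        Wp splitLoop s2 fun k s' => k ≤ (b + 1) * 12 + 1 ∧ s'.mem = s.mem ∧ s'.reg rBest =
          (Finset.range (i + 1)).sup fun a' => (Finset.range (b + 1)).sup fun j =>
            combine (cell D β s₀.mem p a (r + if a' < a then 1 else 0) (b - j))
              (cell D β s₀.mem c a' (if a < a' then 1 else 0) j) := by
      intro s2 hs2 hm2 hJ hP hQ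
      refine (wp_splitLoop ((hs2 _ (by decide) (by decide) (by decide)).trans f0)
        ((hs2 _ (by decide) (by decide) (by decide)).trans f1) hP hQ hJ
        ((hs2 _ (by decide) (by decide) (by decide)).trans f5)
        ((hs2 _ (by decide) (by decide) (by decide)).trans h4)).mono ?_
      rintro k s3 - ⟨hk, h31, h32⟩
      refine ⟨hk, by rw [h31, hm2, h3], ?_⟩
      rw [h32, show Finset.range (i + 1) = insert i (Finset.range i) from Finset.range_add_one,
        Finset.sup_insert, hm2, h3, max_comm]
      refine congrArg (fun z : ℕ => max z _) (Finset.sup_congr rfl fun j hj => ?_)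
      have hj' : j ≤ b := by simpa [Nat.lt_succ_iff] using hj
      -- both cells lie below the place where the new table begins
      have haD : (a * D + r + 1) * (β + 1) ≤ (lam + 2) * (D * (β + 1)) := by
        rw [← mul_assoc]
        refine Nat.mul_le_mul_right _ ?_
        calc a * D + r + 1 ≤ (a + 1) * D := by rw [Nat.succ_mul]; omega
          _ ≤ _ := Nat.mul_le_mul_right _ (by omega)
      have hiD : (i * D + 2) * (β + 1) ≤ (lam + 2) * (D * (β + 1)) := by
        rw [← mul_assoc]
        refine Nat.mul_le_mul_right _ ?_
        calc i * D + 2 ≤ (i + 1) * D := by rw [Nat.succ_mul]; omega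
          _ ≤ _ := Nat.mul_le_mul_right _ (by omega)
      rw [add_mul] at haD hiD
      have e1 : p + ((a * D + r) * (β + 1) + b) + (if i < a then β + 1 else 0) - j =
          p + ((a * D + (r + if i < a then 1 else 0)) * (β + 1) + (b - j)) := by
        split_ifs
        · rw [← add_assoc (a * D), add_mul _ 1]; omega
        · simp only [add_zero]; omega
      have e2 : c + i * (D * (β + 1)) + (if a < i then β + 1 else 0) + j =
          c + ((i * D + if a < i then 1 else 0) * (β + 1) + j) := by
        split_ifs
        · ring
        · ring
      unfold cell
      rw [← e1, ← e2, hmem, hmem]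
      · have e3 := mul_assoc i D (β + 1)
        split_ifs <;> omega
      · split_ifs <;> omega
    simp only [wp_block_cons, wp_block_nil, wp_const, wp_copy, wp_add, wp_ifLt, wp_skip,
      State.setReg_reg, ↓reduceIte, Nat.reduceEqDiff, h1, h2, f2, f4, f6]
    have fin : ∀ s2 : State, (∀ q, q ≠ rP → q ≠ rQ → q ≠ rJ → s2.reg q = s1.reg q) →
        s2.mem = s1.mem → s2.reg rJ = 0 →
        s2.reg rP = p + ((a * D + r) * (β + 1) + b) + (if i < a then β + 1 else 0) →
        s2.reg rQ = c + i * (D * (β + 1)) + (if a < i then β + 1 else 0) →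
        Wp splitLoop s2 fun k s' =>
          1 + (1 + (1 + 1 + (1 + 1 + (1 + (k + (1 + (1 + 1))))))) + 1 ≤ (β + 1) * 12 + 13 ∧
          s'.reg rAc + s'.reg rOne = i + 1 ∧
          s'.reg rRow + s'.reg rDB = c + (i + 1) * (D * (β + 1)) ∧
          ((s'.setReg rRow (s'.reg rRow + s'.reg rDB)).setReg rAc (s'.reg rAc + s'.reg rOne)).mem
            = s.mem ∧
          s'.reg rBest =
            (Finset.range (i + 1)).sup fun a' => (Finset.range (b + 1)).sup fun j =>
              combine (cell D β s₀.mem p a (r + if a' < a then 1 else 0) (b - j))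
                (cell D β s₀.mem c a' (if a < a' then 1 else 0) j) := by
      intro s2 hs2 hm2 hJ hP hQ
      refine (main s2 hs2 hm2 hJ hP hQ).mono ?_
      rintro k s3 hf3 ⟨hk, h31, h32⟩
      have g : ∀ q, q ∉ splitLoop.writes → q ≠ rP → q ≠ rQ → q ≠ rJ → s3.reg q = s1.reg q :=
        fun q hq hq1 hq2 hq3 => (hf3 q hq).trans (hs2 q hq1 hq2 hq3)
      rw [g rAc (by decide) (by decide) (by decide) (by decide),
        g rOne (by decide) (by decide) (by decide) (by decide),
        g rRow (by decide) (by decide) (by decide) (by decide),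
        g rDB (by decide) (by decide) (by decide) (by decide), h1, h2, f1, f3]
      refine ⟨?_, rfl, by ring, h31, h32⟩
      have : (b + 1) * 12 ≤ (β + 1) * 12 := Nat.mul_le_mul_right _ (by omega)
      omega
    split_ifs with hia hai <;> refine fin _ ?_ rfl ?_ ?_ ?_ <;>
      first
        | (intro q hq1 hq2 hq3; simp [hq1, hq2, hq3])
        | simp [*]
  · rintro k s1 - ⟨hk, -, -, -, h3, h4⟩
    exact ⟨by omega, h4, by simp [h3]⟩

/-! ### Correctness of the cell values -/

theorem isMaxOrZero_initialValue {n lam : ℕ} (G : SimpleGraph (Fin n)) (t : Fin n → ℕ)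
    (v : Fin n) {a : ℕ} (ha : a ≤ lam + 1) (r b : ℕ) :
    IsMaxOrZero (certifiedWeights G t lam {v} v a r b) (initialValue n lam v (t v) a r b) := by
  rw [certifiedWeights_singleton v ha]
  unfold initialValue
  split_ifs with h
  · exact ⟨fun x hx => hx.2.2.le, Or.inr ⟨h.1, h.2, rfl⟩⟩
  · exact ⟨fun x hx => absurd ⟨hx.1, hx.2.1⟩ h, Or.inl rfl⟩

theorem isMaxOrZero_mergeValue {n lam : ℕ} {G : SimpleGraph (Fin n)} {t : Fin n → ℕ}
    {X Y : Finset (Fin n)} {p c : Fin n} (hp : p ∈ X) (hc : c ∈ Y) (hd : Disjoint X Y)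
    (hadj : ∀ x ∈ X, ∀ y ∈ Y, G.Adj x y ↔ x = p ∧ y = c) {a r b : ℕ} {F F' : ℕ → ℕ → ℕ → ℕ}
    (hF : ∀ r' ≤ r + 1, ∀ b' ≤ b, IsMaxOrZero (certifiedWeights G t lam X p a r' b') (F a r' b'))
    (hF' : ∀ a' ≤ lam + 1, ∀ h ≤ 1, ∀ b' ≤ b,
      IsMaxOrZero (certifiedWeights G t lam Y c a' h b') (F' a' h b')) :
    IsMaxOrZero (certifiedWeights G t lam (X ∪ Y) p a r b) (mergeValue lam F F' a r b) := by
  rw [certifiedWeights_union hp hc hd hadj]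
  refine IsMaxOrZero.of_sums
    (f := fun a' j => F a (r + if a' < a then 1 else 0) (b - j))
    (g := fun a' j => F' a' (if a < a' then 1 else 0) j)
    (fun _ _ x hx => pos_of_mem_certifiedWeights hp hx)
    (fun _ _ x hx => pos_of_mem_certifiedWeights hc hx)
    (fun i hi j hj => hF _ (by split_ifs <;> omega) _ (by omega))
    (fun i hi j hj => hF' i hi _ (by split_ifs <;> omega) _ hj) ⟨?_, ?_⟩
  · rintro _ ⟨i, hi, j, hj, h1, h2, rfl⟩
    unfold mergeValue
    refine le_trans ?_ (Finset.le_sup (Finset.mem_range.2 (Nat.lt_succ_of_le hi)))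
    refine le_trans ?_ (Finset.le_sup (Finset.mem_range.2 (Nat.lt_succ_of_le hj)))
    exact (if_pos (c := _ ∧ _) ⟨h1, h2⟩).ge
  · obtain ⟨i, hi, h1⟩ := Finset.exists_mem_eq_sup (Finset.range (lam + 2)) ⟨0, by simp⟩
      fun a' => (Finset.range (b + 1)).sup fun j =>
        combine (F a (r + if a' < a then 1 else 0) (b - j)) (F' a' (if a < a' then 1 else 0) j)
    obtain ⟨j, hj, h2⟩ := Finset.exists_mem_eq_sup (Finset.range (b + 1)) ⟨0, by simp⟩
      fun j => combine (F a (r + if i < a then 1 else 0) (b - j)) (F' i (if a < i then 1 else 0) j)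
    have h3 := h1.trans h2
    unfold mergeValue
    rw [h3]
    by_cases h : 0 < F a (r + if i < a then 1 else 0) (b - j) ∧
      0 < F' i (if a < i then 1 else 0) j
    · rw [combine, if_pos h]
      exact Or.inr ⟨i, by simpa [Nat.lt_succ_iff] using hi, j,
        by simpa [Nat.lt_succ_iff] using hj, h.1, h.2, rfl⟩
    · rw [combine, if_neg h]
      exact Or.inl rfl

/-- A partial breadth-first search: the vertices `q 0, …, q (tail - 1)` have been found, each but
the first through its neighbour `par i`, and all neighbours of the first `done` of them. -/
structure Search {n : ℕ} (G : SimpleGraph (Fin n)) (q par : ℕ → Fin n) (tail done : ℕ) : Prop where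
  pos : 0 < tail
  done_le : done ≤ tail
  inj : ∀ i < tail, ∀ j < tail, q i = q j → i = j
  parent : ∀ i < tail, 0 < i → ∃ j < i, par i = q j ∧ G.Adj (q j) (q i)
  closed : ∀ j < done, ∀ u, G.Adj (q j) u → ∃ i < tail, q i = u

theorem Search.tail_le {n : ℕ} {G : SimpleGraph (Fin n)} {q par : ℕ → Fin n} {tail done : ℕ}
    (h : Search G q par tail done) : tail ≤ n := by
  have := Finset.card_le_card_of_injOn (s := Finset.range tail) (t := Finset.univ) q (by simp)
    fun i hi j hj e => h.inj i (by simpa using hi) j (by simpa using hj) e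
  simpa using this

theorem Search.exists_eq {n : ℕ} {G : SimpleGraph (Fin n)} {q par : ℕ → Fin n} {tail : ℕ}
    (h : Search G q par tail tail) (hG : G.Connected) (v : Fin n) : ∃ i < tail, q i = v := by
  have hr := hG.preconnected (q 0) v
  rw [SimpleGraph.reachable_iff_reflTransGen] at hr
  induction hr with
  | refl => exact ⟨0, h.pos, rfl⟩
  | tail _ hadj ih =>
    obtain ⟨i, hi, rfl⟩ := ih
    exact h.closed i hi _ hadj

theorem Search.tail_eq {n : ℕ} {G : SimpleGraph (Fin n)} {q par : ℕ → Fin n} {tail : ℕ}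
    (h : Search G q par tail tail) (hG : G.Connected) : tail = n := by
  refine le_antisymm h.tail_le ?_
  have := Finset.card_le_card_of_surjOn (s := Finset.range tail) (t := Finset.univ) q
    fun v _ => by
      obtain ⟨i, hi, e⟩ := h.exists_eq hG v
      exact ⟨i, by simpa using hi, e⟩
  simpa using this

/-- In a tree, the only earlier neighbour of a vertex is the one through which it was found: the
`n - 1` edges used by the search are all edges. -/
theorem Search.eq_par {n : ℕ} {G : SimpleGraph (Fin n)} {q par : ℕ → Fin n}
    (h : Search G q par n n) (hG : G.IsTree) {i j : ℕ} (hi : i < n) (hj : j < i)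
    (hadj : G.Adj (q j) (q i)) : par i = q j := by
  classical
  have hcard := hG.card_edgeFinset
  rw [Fintype.card_fin] at hcard
  have key : ∀ a b c d : ℕ, a < b → b < n → c < d → d < n →
      s(q a, q b) = s(q c, q d) → b = d := by
    intro a b c d hab hb hcd hd e
    rw [Sym2.eq_iff] at e
    rcases e with ⟨e1, e2⟩ | ⟨e1, e2⟩
    · exact h.inj _ hb _ hd e2
    · have := h.inj _ (by omega) _ hd e1
      have := h.inj _ hb _ (by omega) e2
      omega
  have hsurj := Finset.surj_on_of_inj_on_of_card_le (s := Finset.Ico 1 n) (t := G.edgeFinset)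
    (fun i _ => s(par i, q i))
    (fun i hi => by
      rw [Finset.mem_Ico] at hi
      obtain ⟨k, hk, e, hk'⟩ := h.parent i hi.2 hi.1
      rw [e, SimpleGraph.mem_edgeFinset, SimpleGraph.mem_edgeSet]
      exact hk')
    (fun i i' hi hi' e => by
      rw [Finset.mem_Ico] at hi hi'
      obtain ⟨k, hk, e1, -⟩ := h.parent i hi.2 hi.1
      obtain ⟨k', hk', e2, -⟩ := h.parent i' hi'.2 hi'.1
      simp only [e1, e2] at e
      exact key _ _ _ _ hk hi.2 hk' hi'.2 e)
    (by rw [Nat.card_Ico]; omega)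
    s(q j, q i) (by rwa [SimpleGraph.mem_edgeFinset, SimpleGraph.mem_edgeSet])
  obtain ⟨i', hi', e⟩ := hsurj
  rw [Finset.mem_Ico] at hi'
  obtain ⟨k, hk, e1, -⟩ := h.parent i' hi'.2 hi'.1
  simp only [e1] at e
  have hii := key _ _ _ _ hj hi hk hi'.2 e
  subst hii
  have hjk : j = k := by
    rw [Sym2.eq_iff] at e
    rcases e with ⟨e2, -⟩ | ⟨e2, -⟩
    · exact h.inj _ (by omega) _ (by omega) e2
    · have := h.inj _ (by omega) _ (by omega) e2
      omega
  rw [e1, hjk]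

/-! ### Reading the input -/

/-- The address at which the encoding of an instance shows the adjacency list of vertex `k`. -/
def listAt {n : ℕ} (adj : Fin n → List (Fin n)) (k : ℕ) : ℕ :=
  3 + n + (((List.ofFn adj).take k).map fun l => l.length + 1).sum

theorem listAt_succ {n : ℕ} (adj : Fin n → List (Fin n)) (v : Fin n) :
    listAt adj (v + 1) = listAt adj v + (adj v).length + 1 := by
  unfold listAt
  rw [List.map_take, List.sum_take_succ _ _ (by simp), ← List.map_take]
  simp
  omega

theorem listAt_add_length_le {n : ℕ} (adj : Fin n → List (Fin n)) (v : Fin n) :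
    listAt adj v + (adj v).length + 1 ≤ 3 + 2 * n + ∑ u, (adj u).length := by
  rw [← listAt_succ]
  have h : listAt adj (v + 1) ≤ 3 + n + ((List.ofFn adj).map fun l => l.length + 1).sum := by
    unfold listAt
    rw [List.map_take]
    have := List.sum_take_add_sum_drop ((List.ofFn adj).map fun l => l.length + 1) (v + 1)
    omega
  rw [List.map_ofFn, List.sum_ofFn] at h
  simp only [Function.comp_apply, Finset.sum_add_distrib, Finset.sum_const, Finset.card_univ,
    Fintype.card_fin, smul_eq_mul, mul_one] at h
  omega

theorem getElem?_flatMap_add {α β : Type*} (g : α → List β) (l : List α) (k : ℕ) (hk : k < l.length)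
    (i : ℕ) (hi : i < (g l[k]).length) :
    (l.flatMap g)[((l.take k).map fun x => (g x).length).sum + i]? = (g l[k])[i]? := by
  induction l generalizing k with
  | nil => simp at hk
  | cons a l ih =>
    cases k with
    | zero => simpa using List.getElem?_append_left (by simpa using hi)
    | succ k =>
      rw [List.flatMap_cons, List.take_succ_cons, List.map_cons, List.sum_cons, add_assoc,
        List.getElem?_append_right (by omega), Nat.add_sub_cancel_left]
      simpa using ih k (by simpa using hk) (by simpa using hi)

/-- The memory shows the thresholds and the adjacency lists at their places in the encoding. -/
structure InputAt {n : ℕ} (adj : Fin n → List (Fin n)) (t : Fin n → ℕ) (mem : ℕ → ℕ) : Prop where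
  thr : ∀ v : Fin n, mem (3 + v) = t v
  len : ∀ v : Fin n, mem (listAt adj v) = (adj v).length
  nbr : ∀ (v : Fin n) (i : ℕ) (h : i < (adj v).length), mem (listAt adj v + 1 + i) = (adj v)[i]

theorem encodeInstance_eq {n : ℕ} (lam β : ℕ) (t : Fin n → ℕ) (adj : Fin n → List (Fin n)) :
    encodeInstance lam β t adj = [n, lam, β] ++ List.ofFn t ++
      (List.ofFn adj).flatMap fun l => l.length :: l.map fun u : Fin n => (u : ℕ) := by
  simp only [encodeInstance, List.map_id', List.pure_def, List.bind_eq_flatMap, ← List.map_eq_flatMap]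

theorem inputAt_initial {n : ℕ} (lam β : ℕ) (t : Fin n → ℕ) (adj : Fin n → List (Fin n)) :
    InputAt adj t (initial (encodeInstance lam β t adj)).mem := by
  have key : ∀ (v : Fin n) (i : ℕ), i < (adj v).length + 1 →
      (initial (encodeInstance lam β t adj)).mem (listAt adj v + i) =
        ((adj v).length :: (adj v).map fun u : Fin n => (u : ℕ)).getD i 0 := by
    intro v i hi
    have h := getElem?_flatMap_add (fun l : List (Fin n) => l.length :: l.map fun u : Fin n => (u : ℕ))
      (List.ofFn adj) v (by simp) i (by simpa using hi)
    simp only [List.length_cons, List.length_map, List.getElem_ofFn] at h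
    simp only [initial, encodeInstance_eq, listAt, List.getD_eq_getElem?_getD]
    rw [List.getElem?_append_right (by simp; omega), ← h]
    congr 2
    simp
    omega
  refine ⟨fun v => ?_, fun v => by simpa using key v 0 (by omega), fun v i hi => ?_⟩
  · have hv := v.2
    simp only [initial, encodeInstance_eq, List.getD_eq_getElem?_getD]
    rw [List.getElem?_append_left (by simp; omega), List.getElem?_append_right (by simp)]
    simp
  · have := key v (i + 1) (by omega)
    rw [add_assoc, add_comm 1, this]
    simp [hi]

theorem InputAt.congr {n : ℕ} {adj : Fin n → List (Fin n)} {t : Fin n → ℕ} {mem mem' : ℕ → ℕ}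
    (h : InputAt adj t mem) (hb : ∀ v : Fin n, listAt adj v + (adj v).length < 4 * n + 4)
    (hm : ∀ x < 4 * n + 4, mem' x = mem x) : InputAt adj t mem' := by
  refine ⟨fun v => ?_, fun v => ?_, fun v i hi => ?_⟩
  · rw [hm _ (by omega), h.thr]
  · rw [hm _ (by have := hb v; omega), h.len]
  · rw [hm _ (by have := hb v; omega), h.nbr]

/-- Visits the adjacency lists; notes their addresses and the largest degree. -/
def scanLoop : Prog :=
  .whileLt rV rN <| block
    [ .add rX rOff rV, .store rX rP, .load rY rP,
      .ifLt rD rY (.copy rD rY) .skip,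
      .add rP rP rY, .add rP rP rOne, .add rW rW rW, .add rV rV rOne ]

/-- Multiplies by repeated addition: the machine has no product, and a row block of a table has
`(Δ + 2) * (β + 1)` cells. -/
def strideLoop : Prog :=
  .whileLt rI rD <| block [.add rDB rDB rB, .add rI rI rOne]

/-- Sets up the registers below `18`. -/
def setup : Prog := block
  [ .const rX 4, .add rOff rN rN, .add rOff rOff rOff, .add rOff rOff rX,
    .const rThr 3, .add rP rThr rN, .const rW 1, .const rD 0, .const rV 0,
    scanLoop,
    .add rD rD rOne, .add rD rD rOne, .const rX 2, .load rBeta rX, .add rB rBeta rOne,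
    .const rDB 0, .const rI 0,
    strideLoop,
    .load rLam rOne, .add rNever rLam rOne, .add rL rNever rOne,
    .add rSeen rOff rN, .add rQueue rSeen rN, .add rPar rQueue rN, .add rTab rPar rN,
    .add rFree rTab rN ]

theorem wp_scanLoop {n Δ : ℕ} {adj : Fin n → List (Fin n)} {t : Fin n → ℕ} {s : State}
    (h1 : s.reg rOne = 1) (hN : s.reg rN = n) (hO : s.reg rOff = 4 * n + 4)
    (hP : s.reg rP = 3 + n) (hW : s.reg rW = 1) (hD : s.reg rD = 0) (hV : s.reg rV = 0)
    (hin : InputAt adj t s.mem) (hb : ∀ v : Fin n, listAt adj v + (adj v).length < 4 * n + 4)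
    (hΔ : ∀ v, (adj v).length ≤ Δ) :
    Wp scanLoop s fun k s' => k ≤ n * 12 + 1 ∧ s'.reg rW = 2 ^ n ∧ s'.reg rD ≤ Δ ∧
      (∀ v, (adj v).length ≤ s'.reg rD) ∧
      (∀ v : Fin n, s'.mem (4 * n + 4 + v) = listAt adj v) ∧
      ∀ x, x < 4 * n + 4 ∨ 5 * n + 4 ≤ x → s'.mem x = s.mem x := by
  unfold scanLoop
  refine (wp_whileLt n 12 (fun v s' => s'.reg rV = v ∧ s'.reg rP = listAt adj v ∧
    s'.reg rW = 2 ^ v ∧ s'.reg rD ≤ Δ ∧ (∀ u : Fin n, (u : ℕ) < v → (adj u).length ≤ s'.reg rD) ∧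
    (∀ u : Fin n, (u : ℕ) < v → s'.mem (4 * n + 4 + u) = listAt adj u) ∧
    ∀ x, x < 4 * n + 4 ∨ 5 * n + 4 ≤ x → s'.mem x = s.mem x) ?_ ?_ ?_).mono ?_
  · simp [hV, hP, listAt, hW, hD]
  · rintro v s1 - hf ⟨h, -⟩
    rw [h, hf rN (by decide), hN]
  · rintro v s1 hv hf ⟨g1, g2, g3, g4, g5, g6, g7⟩
    have f1 : s1.reg rOne = 1 := (hf rOne (by decide)).trans h1
    have f2 : s1.reg rOff = 4 * n + 4 := (hf rOff (by decide)).trans hO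
    have f3 : s1.mem (listAt adj v) = (adj ⟨v, hv⟩).length := by
      have := hb ⟨v, hv⟩
      simp only at this
      rw [g7 _ (by omega)]
      exact hin.len ⟨v, hv⟩
    have f4 : listAt adj v ≠ 4 * n + 4 + v := by
      have := hb ⟨v, hv⟩
      simp only at this
      omega
    have f5 := listAt_succ adj ⟨v, hv⟩
    simp only at f5
    have new : ∀ d, (adj ⟨v, hv⟩).length ≤ d → s1.reg rD ≤ d →
        ∀ u : Fin n, (u : ℕ) < v + 1 → (adj u).length ≤ d := by
      intro d hd hd' u hu
      by_cases huv : (u : ℕ) = v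
      · rwa [show u = ⟨v, hv⟩ from Fin.ext huv]
      · exact (g5 u (by omega)).trans hd'
    have m1 : ∀ u : Fin n, (u : ℕ) < v + 1 →
        (if 4 * n + 4 + (u : ℕ) = 4 * n + 4 + v then listAt adj v
          else s1.mem (4 * n + 4 + (u : ℕ))) = listAt adj u := by
      intro u hu
      split_ifs with h
      · rw [show v = u by omega]
      · exact g6 u (by omega)
    have m2 : ∀ x, x < 4 * n + 4 ∨ 5 * n + 4 ≤ x →
        (if x = 4 * n + 4 + v then listAt adj v else s1.mem x) = s.mem x := by
      intro x hx
      rw [if_neg (by omega), g7 x hx]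
    simp only [wp_block_cons, wp_block_nil, wp_add, wp_store, wp_load, wp_ifLt, wp_copy, wp_skip,
      State.setReg_reg, State.setReg_mem, State.setMem_reg, State.setMem_mem, ↓reduceIte,
      Nat.reduceEqDiff, f1, f2, f3, g1, g2, g3, if_neg f4]
    split_ifs with hlt
    · exact ⟨by norm_num, trivial, f5.symm, by ring, hΔ _, new _ le_rfl hlt.le, m1, m2⟩
    · exact ⟨by norm_num, trivial, f5.symm, by ring, g4, new _ (by omega) le_rfl, m1, m2⟩
  · rintro k s1 - ⟨hk, -, -, -, h3, h4, h5, h6, h7⟩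
    exact ⟨hk, h3, h4, fun v => h5 v v.2, fun v => h6 v v.2, h7⟩

theorem wp_strideLoop {D w : ℕ} {s : State} (h1 : s.reg rOne = 1) (hD : s.reg rD = D)
    (hB : s.reg rB = w) (h : s.reg rDB = 0) (hI : s.reg rI = 0) :
    Wp strideLoop s fun k s' => k ≤ D * 4 + 1 ∧ s'.reg rDB = D * w ∧ s'.mem = s.mem := by
  unfold strideLoop
  refine (wp_whileLt D 4 (fun i s' => s'.reg rI = i ∧ s'.reg rDB = i * w ∧ s'.mem = s.mem)
    ?_ ?_ ?_).mono ?_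
  · simp [hI, h]
  · rintro i s1 - hf ⟨h, -⟩
    rw [h, hf rD (by decide), hD]
  · rintro i s1 hi hf ⟨g1, g2, g3⟩
    have f1 : s1.reg rOne = 1 := (hf rOne (by decide)).trans h1
    have f2 : s1.reg rB = w := (hf rB (by decide)).trans hB
    simp [g1, g2, g3, f1, f2]
    ring
  · rintro k s1 - ⟨hk, -, -, h2, h3⟩
    exact ⟨hk, h2, h3⟩

theorem wp_setup {n lam β Δ : ℕ} {adj : Fin n → List (Fin n)} {t : Fin n → ℕ} {s : State}
    (h0 : s.reg rZero = 0) (h1 : s.reg rOne = 1) (hN : s.reg rN = n) (hl : s.mem 1 = lam)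
    (hβ : s.mem 2 = β) (hin : InputAt adj t s.mem)
    (hb : ∀ v : Fin n, listAt adj v + (adj v).length < 4 * n + 4) (hΔ : ∀ v, (adj v).length ≤ Δ) :
    Wp setup s fun k s' => k ≤ n * 12 + (Δ + 2) * 4 + 30 ∧ ∃ D, D ≤ Δ + 2 ∧
      (∀ v, (adj v).length + 2 ≤ D) ∧ 2 ≤ D ∧ Env n lam β D s' ∧ s'.reg rFree = 9 * n + 4 ∧
      (∀ v : Fin n, s'.mem (4 * n + 4 + v) = listAt adj v) ∧
      ∀ x, x < 4 * n + 4 ∨ 5 * n + 4 ≤ x → s'.mem x = s.mem x := by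
  unfold setup
  simp only [wp_block_cons, wp_block_nil, wp_add, wp_const, wp_load, State.setReg_reg,
    State.setReg_mem, ↓reduceIte, Nat.reduceEqDiff, hN]
  refine (wp_scanLoop (n := n) (Δ := Δ) (adj := adj) (t := t) (by simp [h1]) (by simp [hN])
    (by simp; ring) (by simp) (by simp) (by simp) (by simp) (by simpa using hin)
    hb hΔ).mono ?_
  rintro k1 s1 hf1 ⟨hk1, hW, hD, hlen, hoff, hmem⟩
  have f0 : s1.reg rZero = 0 := (hf1 rZero (by decide)).trans (by simp [h0])
  have f1 : s1.reg rOne = 1 := (hf1 rOne (by decide)).trans (by simp [h1])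
  have f2 : s1.reg rN = n := (hf1 rN (by decide)).trans (by simp [hN])
  have f3 : s1.reg rThr = 3 := (hf1 rThr (by decide)).trans (by simp)
  have f4 : s1.reg rOff = 4 * n + 4 := (hf1 rOff (by decide)).trans (by simp; ring)
  have f5 : s1.mem 1 = lam := (hmem 1 (by omega)).trans hl
  have f6 : s1.mem 2 = β := (hmem 2 (by omega)).trans hβ
  simp only [State.setReg_mem] at hmem
  simp only [f1, f6]
  refine (wp_strideLoop (D := s1.reg rD + 2) (w := β + 1) (by simp [f1]) (by simp)
    (by simp) (by simp) (by simp)).mono ?_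
  rintro k2 s2 hf2 ⟨hk2, hDB, hm2⟩
  have e0 : s2.reg rZero = 0 := (hf2 rZero (by decide)).trans (by simp [f0])
  have e1 : s2.reg rOne = 1 := (hf2 rOne (by decide)).trans (by simp [f1])
  have e2 : s2.reg rN = n := (hf2 rN (by decide)).trans (by simp [f2])
  have e3 : s2.reg rThr = 3 := (hf2 rThr (by decide)).trans (by simp [f3])
  have e4 : s2.reg rOff = 4 * n + 4 := (hf2 rOff (by decide)).trans (by simp [f4])
  have e5 : s2.reg rW = 2 ^ n := (hf2 rW (by decide)).trans (by simp [hW])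
  have e6 : s2.reg rD = s1.reg rD + 2 := (hf2 rD (by decide)).trans (by simp)
  have e7 : s2.reg rBeta = β := (hf2 rBeta (by decide)).trans (by simp)
  have e8 : s2.reg rB = β + 1 := (hf2 rB (by decide)).trans (by simp)
  have e9 : s2.mem = s1.mem := by simpa using hm2
  simp only [e1, e2, e4, e9, f5]
  clear hf2 hm2
  refine ⟨by linarith, s1.reg rD + 2, by omega, fun v => by have := hlen v; omega, by omega, ?_, ?_,
    hoff, hmem⟩
  · constructor <;> simp [e0, e1, e2, e3, e4, e5, e6, e7, e8, hDB] <;> omega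
  · omega

/-! ### Breadth-first search -/

open Classical in
/-- The memory shows a breadth-first search: from `5 * n + 4` on the flags of the vertices that have
been found, from `6 * n + 4` on the vertices in the order in which they were found, and from
`7 * n + 4` on the vertices through which they were found. -/
structure SearchAt {n : ℕ} (q par : ℕ → Fin n) (tail : ℕ) (mem₀ mem : ℕ → ℕ) : Prop where
  queue : ∀ i < tail, mem (6 * n + 4 + i) = q i
  par : ∀ i < tail, 0 < i → mem (7 * n + 4 + i) = par i
  seen : ∀ v : Fin n, mem (5 * n + 4 + v) = if ∃ i < tail, q i = v then 1 else 0
  old : ∀ x, x < 5 * n + 4 ∨ 8 * n + 4 ≤ x → mem x = mem₀ x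

theorem Search.push {n : ℕ} {G : SimpleGraph (Fin n)} {q par : ℕ → Fin n} {tail i : ℕ}
    (h : Search G q par tail i) (hi : i < tail) {u : Fin n} (hu : G.Adj (q i) u)
    (hnew : ¬ ∃ j < tail, q j = u) :
    Search G (Function.update q tail u) (Function.update par tail (q i)) (tail + 1) i := by
  have e : ∀ j < tail, Function.update q tail u j = q j := fun j hj =>
    Function.update_of_ne (by omega) _ _
  have e' : ∀ j < tail, Function.update par tail (q i) j = par j := fun j hj =>
    Function.update_of_ne (by omega) _ _
  refine ⟨by omega, by have := h.done_le; omega, ?_, ?_, ?_⟩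
  · intro a ha b hb hab
    rcases Nat.lt_succ_iff_lt_or_eq.1 ha with ha | rfl <;>
      rcases Nat.lt_succ_iff_lt_or_eq.1 hb with hb | rfl
    · rw [e a ha, e b hb] at hab
      exact h.inj a ha b hb hab
    · rw [e a ha, Function.update_self] at hab
      exact absurd ⟨a, ha, hab⟩ hnew
    · rw [e b hb, Function.update_self] at hab
      exact absurd ⟨b, hb, hab.symm⟩ hnew
    · rfl
  · intro a ha ha0
    rcases Nat.lt_succ_iff_lt_or_eq.1 ha with ha | rfl
    · obtain ⟨j, hj, h1, h2⟩ := h.parent a ha ha0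
      refine ⟨j, hj, ?_, ?_⟩
      · rw [e' a ha, e j (by omega), h1]
      · rwa [e a ha, e j (by omega)]
    · refine ⟨i, hi, ?_, ?_⟩
      · rw [Function.update_self, e i hi]
      · rwa [Function.update_self, e i hi]
  · intro j hj w hw
    rw [e j (by omega)] at hw
    obtain ⟨k, hk, hk'⟩ := h.closed j hj w hw
    exact ⟨k, by omega, by rw [e k hk, hk']⟩

theorem SearchAt.push {n : ℕ} {q par : ℕ → Fin n} {tail : ℕ} {mem₀ mem : ℕ → ℕ}
    (h : SearchAt q par tail mem₀ mem) (htail : tail < n) (u v : Fin n)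
    {mem' : ℕ → ℕ} (hm : ∀ x, mem' x = if x = 7 * n + 4 + tail then (v : ℕ)
      else if x = 6 * n + 4 + tail then (u : ℕ) else if x = 5 * n + 4 + u then 1 else mem x) :
    SearchAt (Function.update q tail u) (Function.update par tail v) (tail + 1) mem₀ mem' := by
  have e : ∀ j < tail, Function.update q tail u j = q j := fun j hj =>
    Function.update_of_ne (by omega) _ _
  have e' : ∀ j < tail, Function.update par tail v j = par j := fun j hj =>
    Function.update_of_ne (by omega) _ _
  have hu := u.2
  refine ⟨?_, ?_, ?_, ?_⟩
  · intro i hi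
    rcases Nat.lt_succ_iff_lt_or_eq.1 hi with hi | rfl
    · rw [hm, if_neg (by omega), if_neg (by omega), if_neg (by omega), e i hi, h.queue i hi]
    · rw [hm, if_neg (by omega), if_pos rfl, Function.update_self]
  · intro i hi hi0
    rcases Nat.lt_succ_iff_lt_or_eq.1 hi with hi | rfl
    · rw [hm, if_neg (by omega), if_neg (by omega), if_neg (by omega), e' i hi, h.par i hi hi0]
    · rw [hm, if_pos rfl, Function.update_self]
  · intro w
    have hw := w.2
    rw [hm, if_neg (by omega), if_neg (by omega)]
    by_cases hwu : w = u
    · subst hwu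
      rw [if_pos rfl, if_pos ⟨tail, by omega, Function.update_self _ _ _⟩]
    · rw [if_neg (by intro e; exact hwu (Fin.ext (by omega))), h.seen]
      congr 1
      rw [eq_iff_iff]
      constructor
      · rintro ⟨i, hi, h1⟩
        exact ⟨i, by omega, by rw [e i hi, h1]⟩
      · rintro ⟨i, hi, h1⟩
        rcases Nat.lt_succ_iff_lt_or_eq.1 hi with hi | rfl
        · exact ⟨i, hi, by rw [← e i hi, h1]⟩
        · rw [Function.update_self] at h1
          exact absurd h1.symm hwu
  · intro x hx
    rw [hm, if_neg (by omega), if_neg (by omega), if_neg (by omega), h.old x hx]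

/-- Appends to the queue those neighbours of `rV` that have not been found before. -/
def visitLoop : Prog :=
  .whileLt rP rZ <| block
    [ .load rQ rP, .add rX rSeen rQ, .load rY rX,
      .ifLt rY rOne
        (block [.store rX rOne, .add rX rQueue rTail, .store rX rQ, .add rX rPar rTail,
          .store rX rV, .add rTail rTail rOne])
        .skip,
      .add rP rP rOne ]

/-- Breadth-first search from the vertex `0`. -/
def search : Prog := block
  [ .store rSeen rOne, .store rQueue rZero, .const rTail 1, .const rI 0,
    .whileLt rI rTail <| block
      [ .add rX rQueue rI, .load rV rX, .add rX rOff rV, .load rP rX, .load rY rP,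
        .add rP rP rOne, .add rZ rP rY,
        visitLoop,
        .add rI rI rOne ] ]

theorem wp_visitLoop {n lam β D i tail : ℕ} {G : SimpleGraph (Fin n)}
    {adj : Fin n → List (Fin n)} {t : Fin n → ℕ} {q par : ℕ → Fin n} {mem₀ : ℕ → ℕ} {s : State}
    (E : Env n lam β D s) (hadj : IsAdjacencyLists G adj) (hin : InputAt adj t mem₀)
    (hb : ∀ v : Fin n, listAt adj v + (adj v).length < 4 * n + 4)
    (hV : s.reg rV = q i) (hP : s.reg rP = listAt adj (q i) + 1)
    (hZ : s.reg rZ = listAt adj (q i) + 1 + (adj (q i)).length) (hT : s.reg rTail = tail)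
    (hi : i < tail) (hS : Search G q par tail i) (hM : SearchAt q par tail mem₀ s.mem) :
    Wp visitLoop s fun k s' => k ≤ (adj (q i)).length * 14 + 1 ∧
      ∃ q' par' tail', q' 0 = q 0 ∧ s'.reg rTail = tail' ∧ i < tail' ∧
        Search G q' par' tail' (i + 1) ∧ SearchAt q' par' tail' mem₀ s'.mem := by
  unfold visitLoop
  refine (wp_whileLt (adj (q i)).length 14 (fun m s' => s'.reg rP = listAt adj (q i) + 1 + m ∧
    ∃ q' par' tail', q' 0 = q 0 ∧ q' i = q i ∧ s'.reg rTail = tail' ∧ i < tail' ∧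
      Search G q' par' tail' i ∧ SearchAt q' par' tail' mem₀ s'.mem ∧
      ∀ (m' : ℕ) (h : m' < (adj (q i)).length), m' < m → ∃ j < tail', q' j = (adj (q i))[m'])
    ?_ ?_ ?_).mono ?_
  · exact ⟨hP, q, par, tail, rfl, rfl, hT, hi, hS, hM, fun m' _ h => absurd h (by omega)⟩
  · rintro m s1 - hf ⟨h1, -⟩
    rw [h1, hf rZ (by decide), hZ]
    omega
  · rintro m s1 hm hf ⟨g1, q', par', tail', g2, g3, g4, g5, g6, g7, g8⟩
    have f1 : s1.reg rOne = 1 := (hf rOne (by decide)).trans E.one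
    have f2 : s1.reg rSeen = 5 * n + 4 := (hf rSeen (by decide)).trans E.seen
    have f3 : s1.reg rQueue = 6 * n + 4 := (hf rQueue (by decide)).trans E.queue
    have f4 : s1.reg rPar = 7 * n + 4 := (hf rPar (by decide)).trans E.par
    have f5 : s1.reg rV = q i := (hf rV (by decide)).trans hV
    have f6 : s1.mem (listAt adj (q i) + 1 + m) = (adj (q i))[m] := by
      rw [g7.old _ (by have := hb (q i); omega), hin.nbr (q i) m hm]
    set u := (adj (q i))[m] with hu
    have f7 := g7.seen u
    have hadj' : G.Adj (q' i) u := by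
      rw [g3, ← (hadj (q i)).2]
      exact List.getElem_mem hm
    simp only [wp_block_cons, wp_block_nil, wp_add, wp_store, wp_load, wp_ifLt, wp_skip,
      State.setReg_reg, State.setReg_mem, State.setMem_reg, ↓reduceIte,
      Nat.reduceEqDiff, f1, f2, f3, f4, f5, f6, f7, g1, g4]
    by_cases hseen : ∃ j < tail', q' j = u
    · rw [if_pos hseen, if_neg (by omega)]
      refine ⟨by norm_num, by omega, q', par', tail', g2, g3, rfl, g5, g6, g7, ?_⟩
      intro m' hm' hlt
      rcases Nat.lt_succ_iff_lt_or_eq.1 hlt with hlt | rfl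
      · exact g8 m' hm' hlt
      · exact hseen
    · rw [if_neg hseen, if_pos (by omega)]
      have hS' := g6.push g5 hadj' hseen
      have e : ∀ j < tail', Function.update q' tail' u j = q' j := fun j hj =>
        Function.update_of_ne (by omega) _ _
      refine ⟨by norm_num, by omega, Function.update q' tail' u,
        Function.update par' tail' (q' i), tail' + 1, ?_, ?_, rfl, by omega, hS', ?_, ?_⟩
      · rw [e 0 (by omega), g2]
      · rw [e i g5, g3]
      · refine g7.push hS'.tail_le u (q' i) fun x => ?_
        simp only [State.setMem_mem, State.setReg_mem, g3]
      · intro m' hm' hlt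
        rcases Nat.lt_succ_iff_lt_or_eq.1 hlt with hlt | rfl
        · obtain ⟨j, hj, hj'⟩ := g8 m' hm' hlt
          exact ⟨j, by omega, by rw [e j hj, hj']⟩
        · exact ⟨tail', by omega, Function.update_self _ _ _⟩
  · rintro k s1 - ⟨hk, -, -, q', par', tail', g2, g3, g4, g5, g6, g7, g8⟩
    refine ⟨hk, q', par', tail', g2, g4, g5, ⟨g6.pos, by omega, g6.inj, g6.parent, ?_⟩, g7⟩
    intro j hj w hw
    rcases Nat.lt_succ_iff_lt_or_eq.1 hj with hj | rfl
    · exact g6.closed j hj w hw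
    · rw [g3, ← (hadj (q j)).2] at hw
      obtain ⟨m', hm', rfl⟩ := List.getElem_of_mem hw
      exact g8 m' hm' hm'

theorem wp_search {n lam β D Δ : ℕ} {G : SimpleGraph (Fin n)}
    {adj : Fin n → List (Fin n)} {t : Fin n → ℕ} {s : State}
    (E : Env n lam β D s) (hn : 0 < n) (hG : G.Connected) (hadj : IsAdjacencyLists G adj)
    (hin : InputAt adj t s.mem) (hb : ∀ v : Fin n, listAt adj v + (adj v).length < 4 * n + 4)
    (hΔ : ∀ v, (adj v).length ≤ Δ) (hoff : ∀ v : Fin n, s.mem (4 * n + 4 + v) = listAt adj v)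
    (hzero : ∀ v : Fin n, s.mem (5 * n + 4 + v) = 0) :
    Wp search s fun k s' => k ≤ n * (Δ * 14 + 12) + 7 ∧
      ∃ q par, (q 0 : ℕ) = 0 ∧ Search G q par n n ∧ SearchAt q par n s.mem s'.mem := by
  unfold search
  simp only [wp_block_cons, wp_block_nil, wp_const, wp_store,
    State.setMem_reg]
  refine (wp_whileLt n (Δ * 14 + 12) (fun i s' => s'.reg rI = i ∧
    ∃ q par tail, (q 0 : ℕ) = 0 ∧ s'.reg rTail = tail ∧ Search G q par tail i ∧
      SearchAt q par tail s.mem s'.mem) ?_ ?_ ?_).mono ?_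
  · refine ⟨by simp, fun _ => ⟨0, hn⟩, fun _ => ⟨0, hn⟩, 1, rfl, by simp,
      ⟨one_pos, by omega, by omega, by omega, by omega⟩, ?_, by omega, ?_, ?_⟩
    · intro i hi
      have : i = 0 := by omega
      simp [this, E.zero, E.queue]
    · intro v
      have hv := v.2
      have e : 5 * n + 4 + (v : ℕ) ≠ 6 * n + 4 := by omega
      simp [E.seen, E.one, E.queue, e, hzero, Fin.ext_iff, eq_comm (a := 0)]
    · intro x hx
      have e1 : x ≠ 6 * n + 4 := by omega
      have e2 : x ≠ 5 * n + 4 := by omega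
      simp [E.seen, E.queue, e1, e2]
  · rintro i s1 hi hf ⟨h1, q, par, tail, -, h2, h3, -⟩
    rw [h1, h2]
    refine ⟨fun h => lt_of_lt_of_le h h3.tail_le, fun h => ?_⟩
    by_contra hle
    have : tail = i := le_antisymm (by omega) h3.done_le
    subst this
    exact h.ne (h3.tail_eq hG)
  · rintro i s1 hi hf ⟨h1, q, par, tail, h2, h3, h4, h5⟩
    have E1 : Env n lam β D s1 := E.of_eq fun r hr => by
      rw [hf r (by interval_cases r <;> decide)]
      simp only [State.setReg_reg, State.setMem_reg]
      split_ifs <;> omega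
    have hit : i < tail := by
      by_contra hle
      have : tail = i := le_antisymm (by omega) h4.done_le
      subst this
      exact hi.ne (h4.tail_eq hG)
    have m1 : s1.mem (6 * n + 4 + i) = q i := h5.queue i hit
    have m2 : s1.mem (4 * n + 4 + (q i : ℕ)) = listAt adj (q i) := by
      rw [h5.old _ (by have := (q i).2; omega), hoff]
    have m3 : s1.mem (listAt adj (q i)) = (adj (q i)).length := by
      rw [h5.old _ (by have := hb (q i); omega), hin.len]
    simp only [State.setReg_reg, State.setReg_mem, ↓reduceIte, Nat.reduceEqDiff, h1, E1.queue,
      E1.off, E1.one, m1, m2, m3, wp_block_cons, wp_block_nil, wp_add, wp_load]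
    refine (wp_visitLoop (E1.of_eq ?_) hadj hin hb (i := i) (tail := tail) (q := q) (par := par)
      (by simp) (by simp) (by simp) (by simpa using h3) hit h4 (by simpa using h5)).mono ?_
    · intro r hr
      simp only [State.setReg_reg]
      split_ifs <;> omega
    · rintro k s2 hf2 ⟨hk, q', par', tail', g1, g2, g3, g4, g5⟩
      have e1 : s2.reg rOne = 1 := (hf2 rOne (by decide)).trans (by simp [E1.one])
      have e2 : s2.reg rI = i := (hf2 rI (by decide)).trans (by simp [h1])
      refine ⟨?_, by rw [e1, e2], q', par', tail', by rw [g1, h2], g2, g4, g5⟩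
      have := hΔ (q i)
      linarith
  · rintro k s1 - ⟨hk, -, -, q, par, tail, h2, -, h4, h5⟩
    have ht : tail = n := le_antisymm h4.tail_le h4.done_le
    subst ht
    exact ⟨by linarith, q, par, h2, h4, h5⟩

/-! ### The tables of the single vertices -/

/-- The table of the part `X` with distinguished vertex `v`, to which the array from `8 * n + 4` on
points, is correct in the rows `r` with `r + d < D`. (Merging reads the next row, so each merge
costs one row.) -/
def TableAt {n : ℕ} (G : SimpleGraph (Fin n)) (t : Fin n → ℕ) (lam β D : ℕ) (X : Finset (Fin n))
    (v : Fin n) (d : ℕ) (s : State) : Prop :=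
  ∃ base, s.mem (8 * n + 4 + v) = base ∧ 9 * n + 4 ≤ base ∧
    base + (lam + 2) * (D * (β + 1)) ≤ s.reg rFree ∧
    ∀ a ≤ lam + 1, ∀ r, r + d < D → ∀ b ≤ β,
      IsMaxOrZero (certifiedWeights G t lam X v a r b) (cell D β s.mem base a r b)

theorem cell_index_lt {lam β D a r b : ℕ} (ha : a ≤ lam + 1) (hr : r < D) (hb : b ≤ β) :
    (a * D + r) * (β + 1) + b < (lam + 2) * (D * (β + 1)) := by
  have h : (a * D + r + 1) * (β + 1) ≤ (lam + 2) * (D * (β + 1)) := by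
    rw [← mul_assoc]
    refine Nat.mul_le_mul_right _ ?_
    calc a * D + r + 1 ≤ (a + 1) * D := by rw [Nat.succ_mul]; omega
      _ ≤ _ := Nat.mul_le_mul_right _ (by omega)
  rw [Nat.succ_mul] at h
  omega

section

variable {n lam β D : ℕ} {G : SimpleGraph (Fin n)} {t : Fin n → ℕ} {X : Finset (Fin n)}
  {v : Fin n} {d : ℕ}

theorem TableAt.congr {s s' : State} (h : TableAt G t lam β D X v d s)
    (hv : s'.mem (8 * n + 4 + v) = s.mem (8 * n + 4 + v))
    (hm : ∀ x, 9 * n + 4 ≤ x → x < s.reg rFree → s'.mem x = s.mem x)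
    (hf : s.reg rFree ≤ s'.reg rFree) : TableAt G t lam β D X v d s' := by
  obtain ⟨base, h1, h2, h3, h4⟩ := h
  refine ⟨base, hv.trans h1, h2, by omega, fun a ha r hr b hb => ?_⟩
  have := cell_index_lt ha (show r < D by omega) hb
  have e : cell D β s'.mem base a r b = cell D β s.mem base a r b := hm _ (by omega) (by omega)
  rw [e]
  exact h4 a ha r hr b hb

theorem Filled.tableAt {f : ℕ → ℕ → ℕ → ℕ} {s s' : State}
    (h : Filled D β f s ((lam + 2) * (D * (β + 1))) s')
    (hv : s'.mem (8 * n + 4 + v) = s.reg rFree) (hs : 9 * n + 4 ≤ s.reg rFree)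
    (hf : ∀ a ≤ lam + 1, ∀ r, r + d < D → ∀ b ≤ β,
      IsMaxOrZero (certifiedWeights G t lam X v a r b) (f a r b)) :
    TableAt G t lam β D X v d s' := by
  refine ⟨_, hv, hs, h.free.ge, fun a ha r hr b hb => ?_⟩
  rw [cell, h.new _ (cell_index_lt ha (by omega) hb), cellValue_index f (by omega) hb]
  exact hf a ha r hr b hb

end

/-- Sets up the tables of the single vertices. -/
def initTables : Prog := block
  [ .const rV 0, .const rPow 1,
    .whileLt rV rN <| block
      [ .add rX rTab rV, .add rFree rFree rB, .store rX rFree, .add rX rThr rV, .load rTv rX,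
        fill initialCell,
        .add rPow rPow rPow, .add rV rV rOne ] ]

theorem wp_initTables {n lam β D : ℕ} (G : SimpleGraph (Fin n)) {t : Fin n → ℕ} {s : State}
    (E : Env n lam β D s) (ht : ∀ v : Fin n, s.mem (3 + v) = t v)
    (hfree : s.reg rFree = 9 * n + 4) :
    Wp initTables s fun k s' =>
      k ≤ n * ((lam + 2) * (D * ((β + 1) * 11 + 6) + 6) + 12) + 4 ∧
      (∀ v, TableAt G t lam β D {v} v 0 s') ∧ 9 * n + 4 ≤ s'.reg rFree ∧
      ∀ x < 8 * n + 4, s'.mem x = s.mem x := by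
  unfold initTables
  simp only [wp_block_cons, wp_block_nil, wp_const]
  refine (wp_whileLt n ((lam + 2) * (D * ((β + 1) * 11 + 6) + 6) + 12) (fun v s' =>
    s'.reg rV = v ∧ s'.reg rPow = 2 ^ v ∧ (∀ u : Fin n, (u : ℕ) < v → TableAt G t lam β D {u} u 0 s') ∧
      9 * n + 4 ≤ s'.reg rFree ∧ ∀ x < 8 * n + 4, s'.mem x = s.mem x) ?_ ?_ ?_).mono ?_
  · simp [hfree]
  · rintro v s1 - hf ⟨h1, -⟩
    rw [h1, hf rN (by decide)]
    simp [E.N]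
  · rintro v s1 hv hf ⟨h1, h2, h3, h4, h5⟩
    have E1 : Env n lam β D s1 := E.of_eq fun r hr => by
      rw [hf r ((by decide : ∀ r < 17, r ∉ Prog.writes _) r hr)]
      simp only [State.setReg_reg]
      split_ifs <;> omega
    have m1 : s1.mem (3 + v) = t ⟨v, hv⟩ := by
      rw [h5 _ (by omega)]
      exact ht ⟨v, hv⟩
    have m2 : 3 + v ≠ 8 * n + 4 + v := by omega
    simp only [wp_block_cons, wp_block_nil, wp_add, wp_store, wp_load, State.setReg_reg,
      State.setReg_mem, State.setMem_reg, State.setMem_mem, ↓reduceIte, Nat.reduceEqDiff, h1, m1,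
      if_neg m2, E1.tab, E1.thr, E1.B]
    have E2 : ∀ x y z w, Env n lam β D ((((((s1.setReg rX x).setReg rFree y).setMem z w).setReg
        rX (3 + v)).setReg rTv (t ⟨v, hv⟩))) := fun x y z w => E1.of_eq fun r hr => by
      simp only [State.setReg_reg, State.setMem_reg]
      split_ifs <;> omega
    refine (wp_fill (E2 _ _ _ _) (initialValue n lam v (t ⟨v, hv⟩)) 6 (by decide) ?_).mono ?_
    · rintro a r b ha hr hb s2 hs2 ga gr gb - -
      refine wp_initialCell (E1.of_eq fun r hr => ?_) ?_ ?_ ga gr gb ha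
      · rw [hs2 r (by omega) (by omega)]
        simp only [State.setReg_reg, State.setMem_reg]
        split_ifs <;> omega
      · rw [hs2 rTv (by norm_num) (by norm_num)]
        simp
      · rw [hs2 rPow (by norm_num) (by norm_num)]
        simp [h2]
    · rintro k s2 hf2 ⟨hk, hF⟩
      have e1 : s2.reg rOne = 1 := (hf2 rOne (by decide)).trans (by simp [E1.one])
      have e2 : s2.reg rV = v := (hf2 rV (by decide)).trans (by simp [h1])
      have e3 : s2.reg rPow = 2 ^ v := (hf2 rPow (by decide)).trans (by simp [h2])
      have e4 : s2.reg rFree = s1.reg rFree + (β + 1) + (lam + 2) * (D * (β + 1)) := by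
        simpa using hF.free
      have e5 : ∀ x < s1.reg rFree + (β + 1),
          s2.mem x = if x = 8 * n + 4 + v then s1.reg rFree + (β + 1) else s1.mem x := by
        simpa using hF.old
      simp only [e1, e2, e3]
      have hnew : TableAt G t lam β D {⟨v, hv⟩} ⟨v, hv⟩ 0 s2 := by
        refine hF.tableAt ?_ ?_ fun a ha r _ b _ => isMaxOrZero_initialValue G t ⟨v, hv⟩ ha r b
        · rw [e5 _ (by simp only; omega)]
          simp
        · simp
          omega
      refine ⟨by linarith, trivial, by ring, fun u hu => ?_, ?_, fun x hx => ?_⟩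
      · refine TableAt.congr (s := s2) ?_ (by simp) (by simp) (by simp)
        by_cases huv : (u : ℕ) = v
        · rwa [show u = ⟨v, hv⟩ from Fin.ext huv]
        · refine (h3 u (by omega)).congr ?_ (fun x hx hx' => ?_) (by omega)
          · rw [e5 _ (by omega), if_neg (by omega)]
          · rw [e5 _ (by omega), if_neg (by omega)]
      · simp [e4]
        omega
      · rw [e5 _ (by omega), if_neg (by omega), h5 x hx]
  · rintro k s1 - ⟨hk, -, -, -, h3, h4, h5⟩
    exact ⟨by linarith, fun v => h3 v v.2, h4, h5⟩

/-! ### Joining the parts -/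

/-- The parts after the vertices `q k, q (k + 1), …` have been merged into their parents: `X i` is
the part of `q i`. -/
structure Parts {n : ℕ} (G : SimpleGraph (Fin n)) (q : ℕ → Fin n) (k : ℕ)
    (X : ℕ → Finset (Fin n)) : Prop where
  mem : ∀ i < k, q i ∈ X i
  disj : ∀ i < k, ∀ j < k, i ≠ j → Disjoint (X i) (X j)
  adj : ∀ i < k, ∀ j < k, i ≠ j → ∀ x ∈ X i, ∀ y ∈ X j, G.Adj x y → x = q i ∧ y = q j
  cover : ∀ v, ∃ i < k, v ∈ X i

theorem Search.parts {n : ℕ} {G : SimpleGraph (Fin n)} {q par : ℕ → Fin n}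
    (h : Search G q par n n) (hG : G.Connected) : Parts G q n fun i => {q i} := by
  refine ⟨by simp, fun i hi j hj hij => ?_, fun i _ j _ _ x hx y hy _ => ?_, fun v => ?_⟩
  · rw [Finset.disjoint_singleton]
    exact fun e => hij (h.inj i hi j hj e)
  · simp_all
  · obtain ⟨i, hi, e⟩ := h.exists_eq hG v
    exact ⟨i, hi, by simp [e]⟩

theorem Parts.merge {n : ℕ} {G : SimpleGraph (Fin n)} {q : ℕ → Fin n} {m j : ℕ}
    {X : ℕ → Finset (Fin n)} (h : Parts G q (m + 1) X) (hj : j < m)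
    (huniq : ∀ i < m, G.Adj (q i) (q m) → i = j) :
    Parts G q m (Function.update X j (X j ∪ X m)) := by
  have e : ∀ i, i ≠ j → Function.update X j (X j ∪ X m) i = X i := fun i hi =>
    Function.update_of_ne hi _ _
  have ej : Function.update X j (X j ∪ X m) j = X j ∪ X m := Function.update_self _ _ _
  -- a vertex that has moved into the part of `q j` has no neighbour in another part
  have key : ∀ i < m, i ≠ j → ∀ x ∈ X j ∪ X m, ∀ y ∈ X i, G.Adj x y → x = q j ∧ y = q i := by
    intro i hi hij x hx y hy hxy
    rcases Finset.mem_union.1 hx with hx | hx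
    · exact h.adj j (by omega) i (by omega) hij.symm x hx y hy hxy
    · obtain ⟨rfl, rfl⟩ := h.adj m (by omega) i (by omega) (by omega) x hx y hy hxy
      exact absurd (huniq i hi hxy.symm) hij
  have keyd : ∀ i < m, i ≠ j → Disjoint (X j ∪ X m) (X i) := by
    intro i hi hij
    rw [Finset.disjoint_union_left]
    exact ⟨h.disj j (by omega) i (by omega) hij.symm, h.disj m (by omega) i (by omega) (by omega)⟩
  refine ⟨fun i hi => ?_, fun i hi i' hi' hii => ?_, fun i hi i' hi' hii => ?_, fun v => ?_⟩
  · by_cases hij : i = j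
    · subst hij
      rw [ej]
      exact Finset.mem_union_left _ (h.mem i (by omega))
    · rw [e i hij]
      exact h.mem i (by omega)
  · by_cases hij : i = j
    · subst hij
      rw [ej, e i' hii.symm]
      exact keyd i' hi' hii.symm
    · by_cases hij' : i' = j
      · subst hij'
        rw [ej, e i hij]
        exact (keyd i hi hij).symm
      · rw [e i hij, e i' hij']
        exact h.disj i (by omega) i' (by omega) hii
  · by_cases hij : i = j
    · subst hij
      rw [ej, e i' hii.symm]
      exact key i' hi' hii.symm
    · by_cases hij' : i' = j
      · subst hij'
        rw [ej, e i hij]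
        intro x hx y hy hxy
        exact (key i hi hij y hy x hx hxy.symm).symm
      · rw [e i hij, e i' hij']
        exact h.adj i (by omega) i' (by omega) hii
  · obtain ⟨i, hi, hv⟩ := h.cover v
    by_cases him : i = m
    · subst him
      exact ⟨j, hj, by rw [ej]; exact Finset.mem_union_right _ hv⟩
    · by_cases hij : i = j
      · subst hij
        exact ⟨i, hj, by rw [ej]; exact Finset.mem_union_left _ hv⟩
      · exact ⟨i, by omega, by rw [e i hij]; exact hv⟩

open Classical in
/-- The number of neighbours of `q i` that have been merged into their parents, when those from
`q k` on have. -/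
noncomputable def mergedNeighbours {n : ℕ} (G : SimpleGraph (Fin n)) (q : ℕ → Fin n) (k i : ℕ) :
    ℕ :=
  ((Finset.Ico k n).filter fun j => G.Adj (q i) (q j)).card

theorem mergedNeighbours_self {n : ℕ} (G : SimpleGraph (Fin n)) (q : ℕ → Fin n) (i : ℕ) :
    mergedNeighbours G q n i = 0 := by
  simp [mergedNeighbours]

open Classical in
theorem mergedNeighbours_eq {n : ℕ} (G : SimpleGraph (Fin n)) (q : ℕ → Fin n) {m : ℕ} (hm : m < n)
    (i : ℕ) : mergedNeighbours G q m i =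
      mergedNeighbours G q (m + 1) i + if G.Adj (q i) (q m) then 1 else 0 := by
  unfold mergedNeighbours
  rw [← Finset.insert_Ico_add_one_left_eq_Ico hm, Finset.filter_insert]
  split_ifs
  · rw [Finset.card_insert_of_notMem (by simp)]
  · simp

theorem mergedNeighbours_le {n : ℕ} {G : SimpleGraph (Fin n)} {adj : Fin n → List (Fin n)}
    (hadj : IsAdjacencyLists G adj) {q par : ℕ → Fin n} (h : Search G q par n n) (k i : ℕ) :
    mergedNeighbours G q k i ≤ (adj (q i)).length := by
  classical
  rw [← List.toFinset_card_of_nodup (hadj (q i)).1]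
  refine Finset.card_le_card_of_injOn q (fun j hj => ?_) fun a ha b hb e => ?_
  · simp only [Finset.coe_filter, Finset.mem_Ico, Set.mem_ofPred_eq] at hj
    simpa [(hadj (q i)).2] using hj.2
  · simp only [Finset.coe_filter, Finset.mem_Ico, Set.mem_ofPred_eq] at ha hb
    exact h.inj a ha.1.2 b hb.1.2 e

/-- Merges the parts of the vertices into those of their parents, in the reverse order of the
search. -/
def mergeTables : Prog := block
  [ .sub rI rN rOne,
    .whileLt rZero rI <| block
      [ .add rX rQueue rI, .load rV rX, .add rX rPar rI, .load rY rX,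
        .add rX rTab rV, .load rChild rX, .add rX rTab rY, .load rP rX,
        .add rFree rFree rB, .store rX rFree, .sub rDelta rFree rP,
        fill mergeCell,
        .sub rI rI rOne ] ]

theorem wp_mergeTables {n lam β D : ℕ} {G : SimpleGraph (Fin n)} {t : Fin n → ℕ}
    {adj : Fin n → List (Fin n)} {q par : ℕ → Fin n} {s : State}
    (E : Env n lam β D s) (hn : 0 < n) (hG : G.IsTree) (hadj : IsAdjacencyLists G adj)
    (hlen : ∀ v, (adj v).length + 2 ≤ D) (hD : 2 ≤ D) (hS : Search G q par n n)
    (hqueue : ∀ i < n, s.mem (6 * n + 4 + i) = q i)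
    (hpar : ∀ i < n, 0 < i → s.mem (7 * n + 4 + i) = par i) (hT : ∀ v, TableAt G t lam β D {v} v 0 s)
    (hfree : 9 * n + 4 ≤ s.reg rFree) :
    Wp mergeTables s fun k s' =>
      k ≤ n * ((lam + 2) * (D * ((β + 1) * ((lam + 2) * ((β + 1) * 12 + 13) + 13) + 6) + 6) + 18) + 3 ∧
      TableAt G t lam β D Finset.univ (q 0) (mergedNeighbours G q 1 0) s' := by
  unfold mergeTables
  simp only [wp_block_cons, wp_block_nil, wp_sub]
  refine (wp_whileLt (n - 1)
    ((lam + 2) * (D * ((β + 1) * ((lam + 2) * ((β + 1) * 12 + 13) + 13) + 6) + 6) + 18)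
    (fun j s' => s'.reg rI = n - 1 - j ∧ 9 * n + 4 ≤ s'.reg rFree ∧
      (∀ x < 8 * n + 4, s'.mem x = s.mem x) ∧
      ∃ X, Parts G q (n - j) X ∧
        ∀ i < n - j, TableAt G t lam β D (X i) (q i) (mergedNeighbours G q (n - j) i) s')
    ?_ ?_ ?_).mono ?_
  · refine ⟨by simp [E.N, E.one], by simpa using hfree, by simp, fun i => {q i},
      hS.parts hG.connected, fun i _ => ?_⟩
    rw [Nat.sub_zero, mergedNeighbours_self]
    exact (hT (q i)).congr (by simp) (by simp) (by simp)
  · rintro j s1 hj hf ⟨h1, -⟩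
    rw [h1, hf rZero (by decide)]
    simp [E.zero]
  · rintro j s1 hj hf ⟨h1, h2, h3, X, hX, hTX⟩
    have E1 : Env n lam β D s1 := E.of_eq fun r hr => by
      rw [hf r ((by decide : ∀ r < 17, r ∉ Prog.writes _) r hr)]
      simp only [State.setReg_reg]
      split_ifs <;> omega
    obtain ⟨m, hm⟩ : ∃ m, m = n - 1 - j := ⟨_, rfl⟩
    have hm1 : n - j = m + 1 := by omega
    have hm2 : n - (j + 1) = m := by omega
    rw [hm1] at hX hTX
    rw [← hm] at h1
    -- the parent
    obtain ⟨p, hp, hparq, hpadj⟩ := hS.parent m (by omega) (by omega)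
    have huniq : ∀ i < m, G.Adj (q i) (q m) → i = p := fun i hi h =>
      hS.inj i (by omega) p (by omega) ((hS.eq_par hG (by omega) hi h).symm.trans hparq)
    obtain ⟨bc, hc1, hc2, hc3, hc4⟩ := hTX m (by omega)
    obtain ⟨bp, hp1, hp2, hp3, hp4⟩ := hTX p (by omega)
    have m1 : s1.mem (6 * n + 4 + m) = q m := by rw [h3 _ (by omega), hqueue m (by omega)]
    have m2 : s1.mem (7 * n + 4 + m) = q p := by
      rw [h3 _ (by omega), hpar m (by omega) (by omega), hparq]
    have hqp := (q p).2
    have hdm := mergedNeighbours_le hadj hS (m + 1) m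
    have hlm := hlen (q m)
    simp only [wp_block_cons, wp_block_nil, wp_add, wp_store, wp_load, wp_sub, State.setReg_reg,
      State.setReg_mem, State.setMem_reg, ↓reduceIte, Nat.reduceEqDiff, h1, m1, m2, hc1,
      hp1, E1.tab, E1.queue, E1.par, E1.B]
    set base := s1.reg rFree + (β + 1) with hbase
    generalize hs0 : State.setReg _ rDelta _ = s0
    have E0 : Env n lam β D s0 := E1.of_eq fun r hr => by
      rw [← hs0]
      simp only [State.setReg_reg, State.setMem_reg]
      split_ifs <;> omega
    have g1 : s0.reg rFree = base := by simp [← hs0]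
    have g2 : s0.reg rDelta = base - bp := by simp [← hs0]
    have g3 : s0.reg rChild = bc := by simp [← hs0]
    have g4 : s0.reg rI = m := by simp [← hs0, h1]
    have g5 : ∀ x, s0.mem x = if x = 8 * n + 4 + q p then base else s1.mem x := by
      intro x
      simp [← hs0]
    have hcell : ∀ bs a r b, 9 * n + 4 ≤ bs →
        cell D β s0.mem bs a r b = cell D β s1.mem bs a r b := by
      intro bs a r b hbs
      unfold cell
      rw [g5, if_neg (by omega)]
    clear hs0
    refine (wp_fill E0 (mergeValue lam (cell D β s0.mem bp) (cell D β s0.mem bc))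
      ((lam + 2) * ((β + 1) * 12 + 13) + 8) (by decide) ?_).mono ?_
    · intro a r b ha hr hb s2 hs2 ga gr gb gfree gmem
      refine wp_mergeCell (E0.of_eq fun r hr => hs2 r (by omega) (by omega)) hD
        ((hs2 rDelta (by norm_num) (by norm_num)).trans g2)
        ((hs2 rChild (by norm_num) (by norm_num)).trans g3) ga gb gfree ?_ ?_ ?_ gmem ha hr hb <;>
        omega
    · rintro k s2 hf2 ⟨hk, hF⟩
      have e1 : s2.reg rOne = 1 := (hf2 rOne (by decide)).trans E0.one
      have e2 : s2.reg rI = m := (hf2 rI (by decide)).trans g4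
      have e4 := hF.free
      have e5 := hF.old
      rw [g1] at e4 e5
      have e6 : ∀ x < base, x ≠ 8 * n + 4 + q p → s2.mem x = s1.mem x := by
        intro x hx hx'
        rw [e5 x hx, g5, if_neg hx']
      simp only [e1, e2]
      refine ⟨by linarith, by omega, by omega, fun x hx => ?_, Function.update X p (X p ∪ X m),
        ?_, fun i hi => ?_⟩
      · have := e6 x (by omega) (by omega)
        exact this.trans (h3 x hx)
      · rw [hm2]
        exact hX.merge hp huniq
      · rw [hm2] at hi ⊢
        refine TableAt.congr (s := s2) ?_ (by simp) (by simp) (by simp)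
        by_cases hip : i = p
        · subst hip
          rw [Function.update_self]
          have hpm : Disjoint (X i) (X m) := hX.disj i (by omega) m (by omega) (by omega)
          refine hF.tableAt ?_ (by omega) fun a ha r hr b hb => ?_
          · rw [e5 _ (by omega), g5, if_pos rfl, g1]
          · rw [mergedNeighbours_eq G q (by omega), if_pos hpadj] at hr
            refine isMaxOrZero_mergeValue (hX.mem i (by omega)) (hX.mem m (by omega)) hpm
              (fun x hx y hy => ⟨hX.adj i (by omega) m (by omega) (by omega) x hx y hy,
                fun h => by rw [h.1, h.2]; exact hpadj⟩) ?_ ?_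
            · intro r' hr' b' hb'
              rw [hcell _ _ _ _ hp2]
              exact hp4 a ha r' (by omega) b' (by omega)
            · intro a' ha' h hh b' hb'
              rw [hcell _ _ _ _ hc2]
              exact hc4 a' ha' h (by omega) b' (by omega)
        · rw [Function.update_of_ne hip]
          have hqi : (q i : ℕ) ≠ q p := fun e => hip
            (hS.inj i (by omega) p (by omega) (Fin.ext e))
          have hqi' := (q i).2
          have := (hTX i (by omega)).congr (s' := s2) (e6 _ (by omega) (by omega))
            (fun x hx hx' => e6 x (by omega) (by omega)) (by omega)
          obtain ⟨bi, hi1, hi2, hi3, hi4⟩ := this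
          refine ⟨bi, hi1, hi2, hi3, fun a ha r hr b hb => hi4 a ha r ?_ b hb⟩
          rw [mergedNeighbours_eq G q (by omega)] at hr
          omega
  · rintro k s1 - ⟨hk, -, -, h2, h3, X, hX, hTX⟩
    have e : n - (n - 1) = 1 := by omega
    rw [e] at hX hTX
    have hX0 : X 0 = Finset.univ := by
      rw [Finset.eq_univ_iff_forall]
      intro v
      obtain ⟨i, hi, hv⟩ := hX.cover v
      rwa [show i = 0 by omega] at hv
    refine ⟨?_, hX0 ▸ hTX 0 one_pos⟩
    have := Nat.mul_le_mul_right ((lam + 2) * (D * ((β + 1) * ((lam + 2) * ((β + 1) * 12 + 13) + 13)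
      + 6) + 6) + 18) (Nat.sub_le n 1)
    linarith

/-! ### Reading off the solution -/

/-- Finds the largest entry of the table of the vertex `0` in the row without outside helpers. -/
def readBest : Prog := block
  [ .load rRow rTab, .add rRow rRow rBeta, .const rBest 0, .const rAc 0,
    .whileLt rAc rL <| block
      [ .load rX rRow, .ifLt rBest rX (.copy rBest rX) .skip,
        .add rRow rRow rDB, .add rAc rAc rOne ] ]

theorem wp_readBest {n lam β D d : ℕ} {G : SimpleGraph (Fin n)} {t : Fin n → ℕ} {v : Fin n}
    {s : State} (E : Env n lam β D s) (hv : (v : ℕ) = 0) (hd : d < D)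
    (hT : TableAt G t lam β D Finset.univ v d s) :
    Wp readBest s fun k s' => k ≤ (lam + 2) * 7 + 6 ∧ s'.mem = s.mem ∧
      IsMaxOrZero {m | ∃ a ≤ lam + 1, m ∈ certifiedWeights G t lam Finset.univ v a 0 β}
        (s'.reg rBest) := by
  obtain ⟨base, hb, -, -, hT⟩ := hT
  rw [hv, add_zero] at hb
  unfold readBest
  simp only [wp_block_cons, wp_block_nil, wp_add, wp_load, wp_const]
  refine (wp_whileLt (lam + 2) 7 (fun i s' => s'.reg rAc = i ∧
    s'.reg rRow = base + i * (D * (β + 1)) + β ∧ s'.mem = s.mem ∧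
    IsMaxOrZero {m | ∃ a < i, m ∈ certifiedWeights G t lam Finset.univ v a 0 β}
      (s'.reg rBest)) ?_ ?_ ?_).mono ?_
  · simp [E.tab, E.beta, hb, IsMaxOrZero]
  · rintro i s1 - hf ⟨h1, -⟩
    rw [h1, hf rL (by decide)]
    simp [E.L]
  · rintro i s1 hi hf ⟨h1, h2, h3, h4⟩
    have f1 : s1.reg rOne = 1 := (hf rOne (by decide)).trans (by simp [E.one])
    have f2 : s1.reg rDB = D * (β + 1) := (hf rDB (by decide)).trans (by simp [E.stride])
    have m1 := hT i (by omega) 0 (by omega) β le_rfl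
    have e1 : cell D β s.mem base i 0 β = s.mem (base + i * (D * (β + 1)) + β) := by
      rw [cell]
      congr 1
      ring
    rw [e1] at m1
    have e2 : {m | ∃ a < i + 1, m ∈ certifiedWeights G t lam Finset.univ v a 0 β} =
        {m | ∃ a < i, m ∈ certifiedWeights G t lam Finset.univ v a 0 β} ∪
          certifiedWeights G t lam Finset.univ v i 0 β := by
      ext m
      constructor
      · rintro ⟨a, ha, hm⟩
        rcases Nat.lt_succ_iff_lt_or_eq.1 ha with ha | rfl
        · exact Or.inl ⟨a, ha, hm⟩
        · exact Or.inr hm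
      · rintro (⟨a, ha, hm⟩ | hm)
        · exact ⟨a, by omega, hm⟩
        · exact ⟨i, by omega, hm⟩
    have e3 : base + i * (D * (β + 1)) + β + D * (β + 1) =
        base + (i + 1) * (D * (β + 1)) + β := by ring
    have h5 := h4.max m1
    rw [← e2] at h5
    simp only [wp_block_cons, wp_block_nil, wp_add, wp_load, wp_ifLt, wp_copy, wp_skip,
      State.setReg_reg, State.setReg_mem, ↓reduceIte, Nat.reduceEqDiff, h1, h2, h3, f1, f2]
    split_ifs with hlt
    · rw [max_eq_right hlt.le] at h5
      exact ⟨by norm_num, trivial, e3, trivial, h5⟩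
    · rw [max_eq_left (by omega)] at h5
      exact ⟨by norm_num, trivial, e3, trivial, h5⟩
  · rintro k s1 - ⟨hk, -, -, -, h3, h4⟩
    refine ⟨by linarith, by simpa using h3, ?_⟩
    simpa only [Nat.lt_succ_iff] using h4

/-- Decodes the maximum weight and writes the target set into the cells `0, …, n - 1`: subtracts
`n`, discards the digits from `n` on, and shifts the other digits out, from the highest to the
lowest. -/
def writeSolution : Prog := block
  [ .sub rX rBest rN, .add rX rX rOne,
    .whileLt rW rX (.sub rX rX rW),
    .sub rX rX rOne, .copy rV rN,
    .whileLt rZero rV <| block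
      [ .sub rV rV rOne, .add rX rX rX,
        .ifLt rX rW (.store rV rZero) (block [.store rV rOne, .sub rX rX rW]) ] ]

theorem sum_two_pow_filter_succ {n : ℕ} (S : Finset (Fin n)) {v : ℕ} (hv : v < n) :
    ∑ u ∈ S.filter (fun u : Fin n => (u : ℕ) < v + 1), 2 ^ (u : ℕ) =
      ∑ u ∈ S.filter (fun u : Fin n => (u : ℕ) < v), 2 ^ (u : ℕ) +
        if (⟨v, hv⟩ : Fin n) ∈ S then 2 ^ v else 0 := by
  split_ifs with h
  · have e : S.filter (fun u : Fin n => (u : ℕ) < v + 1) =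
        insert ⟨v, hv⟩ (S.filter fun u : Fin n => (u : ℕ) < v) := by
      ext u
      simp only [Finset.mem_filter, Finset.mem_insert, Fin.ext_iff]
      constructor
      · rintro ⟨h1, h2⟩
        by_cases huv : (u : ℕ) = v
        · exact Or.inl huv
        · exact Or.inr ⟨h1, by omega⟩
      · rintro (h1 | ⟨h1, h2⟩)
        · exact ⟨by rwa [show u = ⟨v, hv⟩ from Fin.ext h1], by omega⟩
        · exact ⟨h1, by omega⟩
    rw [e, Finset.sum_insert (by simp), add_comm]
  · rw [add_zero]
    congr 1
    ext u
    simp only [Finset.mem_filter]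
    refine and_congr_right fun h1 => ⟨fun h2 => ?_, fun h2 => by omega⟩
    have : (u : ℕ) ≠ v := fun e => h (by rwa [show u = ⟨v, hv⟩ from Fin.ext e] at h1)
    omega

theorem wp_writeSolution {n lam β D g : ℕ} {S : Finset (Fin n)} {s : State}
    (E : Env n lam β D s) (hg : g ≤ n)
    (hM : s.reg rBest = n + 2 ^ n * g + ∑ u ∈ S, 2 ^ (u : ℕ)) :
    Wp writeSolution s fun k s' => k ≤ n * 10 + 8 ∧
      ∀ v : Fin n, s'.mem v = if v ∈ S then 1 else 0 := by
  have hS : ∑ u ∈ S.filter (fun u : Fin n => (u : ℕ) < n), 2 ^ (u : ℕ) = ∑ u ∈ S, 2 ^ (u : ℕ) := by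
    simp
  have hlt := sum_two_pow_lt (A := S.filter fun u : Fin n => (u : ℕ) < n) fun u _ => u.2
  unfold writeSolution
  simp only [wp_block_cons, wp_block_nil, wp_add, wp_sub, State.setReg_reg, ↓reduceIte,
    Nat.reduceEqDiff, E.one, E.N, hM]
  rw [← hS]
  set L := ∑ u ∈ S.filter (fun u : Fin n => (u : ℕ) < n), 2 ^ (u : ℕ)
  refine (wp_whileLt g 2 (fun j s' => s'.reg rX = 2 ^ n * (g - j) + L + 1 ∧ s'.mem = s.mem)
    ?_ ?_ ?_).mono ?_
  · simp
    omega
  · rintro j s1 hj hf ⟨h1, -⟩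
    rw [h1, hf rW (by decide)]
    simp only [State.setReg_reg, ↓reduceIte, Nat.reduceEqDiff, E.W]
    by_cases hlt' : j < g
    · obtain ⟨i, hi⟩ : ∃ i, g - j = i + 1 := ⟨g - j - 1, by omega⟩
      rw [hi, mul_add, mul_one]
      omega
    · rw [show g - j = 0 by omega, mul_zero]
      omega
  · rintro j s1 hj hf ⟨h1, h2⟩
    have f1 : s1.reg rW = 2 ^ n := (hf rW (by decide)).trans (by simp [E.W])
    obtain ⟨i, hi⟩ : ∃ i, g - j = i + 1 := ⟨g - j - 1, by omega⟩
    rw [hi, mul_add, mul_one] at h1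
    simp only [wp_sub, State.setReg_reg, State.setReg_mem, ↓reduceIte, h1, f1, h2]
    refine ⟨le_rfl, ?_, trivial⟩
    rw [show g - (j + 1) = i by omega]
    omega
  rintro k1 s1 hf1 ⟨hk1, -, hX, hm⟩
  have f0 : s1.reg rZero = 0 := (hf1 rZero (by decide)).trans (by simp [E.zero])
  have f1 : s1.reg rOne = 1 := (hf1 rOne (by decide)).trans (by simp [E.one])
  have f2 : s1.reg rN = n := (hf1 rN (by decide)).trans (by simp [E.N])
  have f3 : s1.reg rW = 2 ^ n := (hf1 rW (by decide)).trans (by simp [E.W])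
  simp only [Nat.sub_self, mul_zero, zero_add] at hX
  simp only [wp_copy, State.setReg_reg, ↓reduceIte, Nat.reduceEqDiff, f1, f2, hX,
    Nat.add_sub_cancel]
  refine (wp_whileLt n 8 (fun j s' => s'.reg rV = n - j ∧
    s'.reg rX = 2 ^ j * ∑ u ∈ S.filter (fun u : Fin n => (u : ℕ) < n - j), 2 ^ (u : ℕ) ∧
    ∀ v : Fin n, n - j ≤ v → s'.mem v = if v ∈ S then 1 else 0) ?_ ?_ ?_).mono ?_
  · refine ⟨by simp, by simp [L], fun v hv => ?_⟩
    have := v.2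
    omega
  · rintro j s2 hj hf ⟨h1, -⟩
    rw [h1, hf rZero (by decide)]
    simp [f0]
  · rintro j s2 hj hf ⟨h1, h2, h3⟩
    have e0 : s2.reg rZero = 0 := (hf rZero (by decide)).trans (by simp [f0])
    have e1 : s2.reg rOne = 1 := (hf rOne (by decide)).trans (by simp [f1])
    have e2 : s2.reg rW = 2 ^ n := (hf rW (by decide)).trans (by simp [f3])
    obtain ⟨v, hv⟩ : ∃ v, n - j = v + 1 := ⟨n - j - 1, by omega⟩
    have hv' : n - (j + 1) = v := by omega
    have hvn : v < n := by omega
    rw [hv, sum_two_pow_filter_succ S hvn] at h2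
    rw [hv] at h1 h3
    rw [hv']
    set T := ∑ u ∈ S.filter (fun u : Fin n => (u : ℕ) < v), 2 ^ (u : ℕ) with hT
    have hTlt := sum_two_pow_lt (A := S.filter fun u : Fin n => (u : ℕ) < v) fun u hu =>
      (Finset.mem_filter.1 hu).2
    rw [← hT] at hTlt
    have hpow : 2 ^ (j + 1) * 2 ^ v = 2 ^ n := by rw [← pow_add]; congr 1; omega
    have hTlt' : 2 ^ (j + 1) * T < 2 ^ n := by
      rw [← hpow]
      exact Nat.mul_lt_mul_of_pos_left hTlt (by positivity)
    have hnew : ∀ x, x = (if (⟨v, hvn⟩ : Fin n) ∈ S then 1 else 0) → ∀ u : Fin n, v ≤ u →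
        (if (u : ℕ) = v then x else s2.mem u) = if u ∈ S then 1 else 0 := by
      intro x hx u hu
      by_cases huv : (u : ℕ) = v
      · rw [if_pos huv, hx, show u = ⟨v, hvn⟩ from Fin.ext huv]
      · rw [if_neg huv, h3 u (by omega)]
    simp only [wp_block_cons, wp_block_nil, wp_add, wp_sub, wp_store, wp_ifLt, State.setReg_reg,
      State.setReg_mem, State.setMem_reg, State.setMem_mem, ↓reduceIte, Nat.reduceEqDiff, e0, e1,
      e2, h1, h2, Nat.add_sub_cancel]
    have hdouble : ∀ y : ℕ, 2 ^ j * y + 2 ^ j * y = 2 ^ (j + 1) * y := fun y => by ring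
    simp only [hdouble]
    by_cases hvS : (⟨v, hvn⟩ : Fin n) ∈ S
    · simp only [if_pos hvS, mul_add, hpow] at hnew ⊢
      rw [if_neg (by omega)]
      exact ⟨by norm_num, trivial, by omega, hnew 1 rfl⟩
    · simp only [if_neg hvS, add_zero] at hnew ⊢
      rw [if_pos hTlt']
      exact ⟨by norm_num, trivial, trivial, hnew 0 rfl⟩
  · rintro k2 s2 - ⟨hk2, -, -, -, h3⟩
    exact ⟨by linarith, fun v => h3 v (by omega)⟩

/-! ### The whole program -/

/-- The dynamic program. A tree with a single vertex `0` needs no work: the input shows `n = 1` in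
the cell `0`, which already says that the target set is `{0}`. -/
def solveTree : Prog := block
  [ .const rOne 1, .load rN rZero,
    .ifLt rOne rN
      (block [setup, search, initTables, mergeTables, readBest, writeSolution]) .skip ]

theorem wp_solveTree {n lam β : ℕ} {G : SimpleGraph (Fin n)} {adj : Fin n → List (Fin n)}
    {t : Fin n → ℕ} {Δ : ℕ} (hG : G.IsTree) (hadj : IsAdjacencyLists G adj) (hn : 2 ≤ n)
    (hΔ : ∀ v, (adj v).length ≤ Δ)
    (hb : ∀ v : Fin n, listAt adj v + (adj v).length < 4 * n + 4)
    (hlen : (encodeInstance lam β t adj).length ≤ 5 * n + 4) :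
    Wp solveTree (initial (encodeInstance lam β t adj)) fun k s => ∃ D ≤ Δ + 2,
      k ≤ (n * 12 + (Δ + 2) * 4 + 30) + (n * (Δ * 14 + 12) + 7) +
        (n * ((lam + 2) * (D * ((β + 1) * 11 + 6) + 6) + 12) + 4) +
        (n * ((lam + 2) * (D * ((β + 1) * ((lam + 2) * ((β + 1) * 12 + 13) + 13) + 6) + 6) + 18)
          + 3) + ((lam + 2) * 7 + 6) + (n * 10 + 8) + 10 ∧
      ∃ S : Finset (Fin n), (∀ v : Fin n, s.mem v = if v ∈ S then 1 else 0) ∧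
        IsMISSolution (Digraph.mk G.Adj) (fun _ _ => 1) t (fun _ => 1) lam β S := by
  set s := initial (encodeInstance lam β t adj) with hs
  have hin : InputAt adj t s.mem := inputAt_initial lam β t adj
  have m0 : s.mem 0 = n := rfl
  have m1 : s.mem 1 = lam := rfl
  have m2 : s.mem 2 = β := rfl
  have r0 : s.reg rZero = 0 := rfl
  have hz : ∀ x, 5 * n + 4 ≤ x → s.mem x = 0 := fun x hx => by
    simp only [hs, initial]
    exact List.getD_eq_default _ _ (by omega)
  clear_value s
  unfold solveTree
  simp only [wp_block_cons, wp_block_nil, wp_const, wp_load, wp_ifLt, State.setReg_reg,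
    State.setReg_mem, ↓reduceIte, Nat.reduceEqDiff, r0, m0, if_pos (show 1 < n by omega)]
  refine (wp_setup (n := n) (Δ := Δ) (adj := adj) (t := t) (by simp [r0]) (by simp) (by simp)
    (by simpa using m1) (by simpa using m2) (by simpa using hin) hb hΔ).mono ?_
  rintro k1 s1 - ⟨hk1, D, hD, hlenD, hD2, E1, hf1, hoff, hmem1⟩
  simp only [State.setReg_mem] at hmem1
  have hin1 : InputAt adj t s1.mem := hin.congr hb fun x hx => hmem1 x (Or.inl hx)
  refine (wp_search E1 (by omega) hG.connected hadj hin1 hb hΔ hoff fun v => by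
    rw [hmem1 _ (by omega), hz _ (by omega)]).mono ?_
  rintro k2 s2 fr2 ⟨hk2, q, par, hq0, hS, hM⟩
  have E2 : Env n lam β D s2 := E1.of_eq fun r hr =>
    fr2 r ((by decide : ∀ r < 17, r ∉ Prog.writes _) r hr)
  have hf2 : s2.reg rFree = 9 * n + 4 := (fr2 rFree (by decide)).trans hf1
  refine (wp_initTables G (t := t) E2 (fun v => ?_) hf2).mono ?_
  · rw [hM.old _ (by omega), hin1.thr]
  rintro k3 s3 fr3 ⟨hk3, hT, hf3, hmem3⟩
  have E3 : Env n lam β D s3 := E2.of_eq fun r hr =>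
    fr3 r ((by decide : ∀ r < 17, r ∉ Prog.writes _) r hr)
  refine (wp_mergeTables E3 (by omega) hG hadj hlenD hD2 hS
    (fun i hi => by rw [hmem3 _ (by omega), hM.queue i hi])
    (fun i hi hi0 => by rw [hmem3 _ (by omega), hM.par i hi hi0]) hT hf3).mono ?_
  rintro k4 s4 fr4 ⟨hk4, hT4⟩
  have E4 : Env n lam β D s4 := E3.of_eq fun r hr =>
    fr4 r ((by decide : ∀ r < 17, r ∉ Prog.writes _) r hr)
  have hd := mergedNeighbours_le hadj hS 1 0
  have hd' := hlenD (q 0)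
  refine (wp_readBest E4 hq0 (by omega) hT4).mono ?_
  rintro k5 s5 fr5 ⟨hk5, -, hbest⟩
  have E5 : Env n lam β D s5 := E4.of_eq fun r hr =>
    fr5 r ((by decide : ∀ r < 17, r ∉ Prog.writes _) r hr)
  obtain ⟨S, g, hg, hval, hsol⟩ := exists_solution_of_max hbest
  refine (wp_writeSolution E5 hg hval).mono ?_
  rintro k6 s6 - ⟨hk6, hout⟩
  exact ⟨D, hD, by linarith, S, hout, hsol⟩

/-- The running times of the phases add up to the claimed bound. -/
theorem time_le {n Δ lam β D k : ℕ} (hn : 2 ≤ n) (hΔ : 1 ≤ Δ) (hΔn : Δ ≤ n) (hl : 1 ≤ lam)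
    (hβ : 1 ≤ β) (hD : D ≤ Δ + 2)
    (hk : k ≤ (n * 12 + (Δ + 2) * 4 + 30) + (n * (Δ * 14 + 12) + 7) +
        (n * ((lam + 2) * (D * ((β + 1) * 11 + 6) + 6) + 12) + 4) +
        (n * ((lam + 2) * (D * ((β + 1) * ((lam + 2) * ((β + 1) * 12 + 13) + 13) + 6) + 6) + 18)
          + 3) + ((lam + 2) * 7 + 6) + (n * 10 + 8) + 10) :
    k ≤ 3000 * min (n * Δ ^ 2 * lam ^ 2 * β ^ 3) (n ^ 2 * lam ^ 2 * β ^ 3) := by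
  obtain ⟨K, hK⟩ : ∃ K, K = n * Δ * lam ^ 2 * β ^ 2 := ⟨_, rfl⟩
  have p1 : 1 ≤ Δ * lam := Nat.mul_pos hΔ hl
  have p2 : 1 ≤ lam * β := Nat.mul_pos hl hβ
  have p3 : 1 ≤ Δ * lam * β := Nat.mul_pos p1 hβ
  have hβ2 : 1 ≤ β ^ 2 := Nat.one_le_pow _ _ hβ
  have p4 : 1 ≤ Δ * lam * β ^ 2 := Nat.mul_pos p1 hβ2
  have p5 : 1 ≤ Δ * lam ^ 2 * β ^ 2 := Nat.mul_pos (Nat.mul_pos hΔ (Nat.one_le_pow _ _ hl)) hβ2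
  have p6 : 1 ≤ lam * β ^ 2 := Nat.mul_pos hl hβ2
  have hD' : D ≤ 3 * Δ := by omega
  have hl' : lam + 2 ≤ 3 * lam := by omega
  have hβ' : β + 1 ≤ 2 * β := by omega
  -- the merges
  have h1 : (lam + 2) * ((β + 1) * 12 + 13) + 13 ≤ 124 * (lam * β) := by
    calc _ ≤ 3 * lam * (37 * β) + 13 * (lam * β) := by gcongr <;> omega
      _ = _ := by ring
  have h2 : (β + 1) * ((lam + 2) * ((β + 1) * 12 + 13) + 13) + 6 ≤ 254 * (lam * β ^ 2) := by
    calc _ ≤ 2 * β * (124 * (lam * β)) + 6 * (lam * β ^ 2) := by gcongr; omega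
      _ = _ := by ring
  have h3 : D * ((β + 1) * ((lam + 2) * ((β + 1) * 12 + 13) + 13) + 6) + 6 ≤
      768 * (Δ * lam * β ^ 2) := by
    calc _ ≤ 3 * Δ * (254 * (lam * β ^ 2)) + 6 * (Δ * lam * β ^ 2) := by gcongr; omega
      _ = _ := by ring
  have h4 : (lam + 2) * (D * ((β + 1) * ((lam + 2) * ((β + 1) * 12 + 13) + 13) + 6) + 6) + 18 ≤
      2322 * (Δ * lam ^ 2 * β ^ 2) := by
    calc _ ≤ 3 * lam * (768 * (Δ * lam * β ^ 2)) + 18 * (Δ * lam ^ 2 * β ^ 2) := by gcongr; omega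
      _ = _ := by ring
  have h5 : n * ((lam + 2) * (D * ((β + 1) * ((lam + 2) * ((β + 1) * 12 + 13) + 13) + 6) + 6) + 18)
      ≤ 2322 * K := by
    calc _ ≤ n * (2322 * (Δ * lam ^ 2 * β ^ 2)) := by gcongr
      _ = _ := by rw [hK]; ring
  -- the tables of the single vertices
  have i1 : D * ((β + 1) * 11 + 6) + 6 ≤ 90 * (Δ * lam * β ^ 2) := by
    calc _ ≤ 3 * Δ * (28 * (lam * β ^ 2)) + 6 * (Δ * lam * β ^ 2) := by
          gcongr
          · have : β ≤ lam * β ^ 2 := by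
              calc β = 1 * β ^ 1 := by ring
                _ ≤ _ := by gcongr; omega
            omega
          · omega
      _ = _ := by ring
  have i2 : n * ((lam + 2) * (D * ((β + 1) * 11 + 6) + 6) + 12) ≤ 282 * K := by
    calc _ ≤ n * (3 * lam * (90 * (Δ * lam * β ^ 2)) + 12 * (Δ * lam ^ 2 * β ^ 2)) := by
          gcongr; omega
      _ = _ := by rw [hK]; ring
  -- everything else is linear
  have j1 : n * Δ ≤ K := by
    calc n * Δ = n * Δ * 1 * 1 := by ring
      _ ≤ n * Δ * lam ^ 2 * β ^ 2 := by
          gcongr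
          · exact Nat.one_le_pow _ _ hl
      _ = K := hK.symm
  have j2 : n * lam ≤ K := by
    calc n * lam = n * 1 * lam ^ 1 * 1 := by ring
      _ ≤ n * Δ * lam ^ 2 * β ^ 2 := by
          gcongr
          · norm_num
      _ = K := hK.symm
  have j3 : n ≤ n * Δ := Nat.le_mul_of_pos_right _ hΔ
  have j4 : Δ ≤ n * Δ := Nat.le_mul_of_pos_left _ (by omega)
  have j5 : lam ≤ n * lam := Nat.le_mul_of_pos_left _ (by omega)
  have j6 : n * (Δ * 14 + 12) = 14 * (n * Δ) + 12 * n := by ring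
  have hkK : k ≤ 3000 * K := by omega
  refine hkK.trans (Nat.mul_le_mul_left _ (le_min ?_ ?_))
  · rw [hK]
    gcongr
    · exact Nat.le_self_pow two_ne_zero _
    · norm_num
  · rw [hK, sq n]
    gcongr
    norm_num

end RAM

theorem corollary1 :
    ∃ (P : RAM.Prog) (C : ℕ),
      ∀ (n : ℕ) (G : SimpleGraph (Fin n)) [DecidableRel G.Adj] (adj : Fin n → List (Fin n))
        (t : Fin n → ℕ) (lam β : ℕ),
        G.IsTree → IsAdjacencyLists G adj → 1 ≤ lam → 1 ≤ β →
        ∃ (k : ℕ) (s : RAM.State) (S : Finset (Fin n)),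
          RAM.Runs P (RAM.initial (encodeInstance lam β t adj)) k s ∧
          k ≤ C * (min (n * G.maxDegree ^ 2 * lam ^ 2 * β ^ 3) (n ^ 2 * lam ^ 2 * β ^ 3) + 1) ∧
          (∀ v : Fin n, s.mem v = if v ∈ S then 1 else 0) ∧
          IsMISSolution (Digraph.mk G.Adj) (fun _ _ => 1) t (fun _ => 1) lam β S := by
  refine ⟨RAM.solveTree, 3000, ?_⟩
  intro n G _ adj t lam β hG hadj hl hβ
  have hdeg : ∀ v, G.degree v = (adj v).length := by
    intro v
    rw [← List.toFinset_card_of_nodup (hadj v).1, ← SimpleGraph.card_neighborFinset_eq_degree]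
    congr 1
    ext u
    simp [(hadj v).2]
  have hn0 : n ≠ 0 := by
    rintro rfl
    exact (hG.connected.nonempty.some).elim0
  by_cases hn : 2 ≤ n
  · have hΔ : ∀ v, (adj v).length ≤ G.maxDegree := fun v => hdeg v ▸ G.degree_le_maxDegree v
    have hsum : ∑ v, (adj v).length = 2 * (n - 1) := by
      have h1 := hG.card_edgeFinset
      rw [Fintype.card_fin] at h1
      rw [← Finset.sum_congr rfl fun v _ => hdeg v, G.sum_degrees_eq_twice_card_edges]
      omega
    have hb : ∀ v : Fin n, RAM.listAt adj v + (adj v).length < 4 * n + 4 := fun v => by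
      have := RAM.listAt_add_length_le adj v
      omega
    have hlen : (encodeInstance lam β t adj).length ≤ 5 * n + 4 := by
      have : (List.map (fun l => l.length + 1) (List.ofFn adj)).sum = ∑ v, ((adj v).length + 1) := by
        rw [List.map_ofFn, List.sum_ofFn]
        rfl
      rw [RAM.encodeInstance_eq]
      simp only [List.length_append, List.length_flatMap, List.length_cons, List.length_map,
        List.length_ofFn, List.length_nil, this, Finset.sum_add_distrib, hsum]
      simp
      omega
    obtain ⟨k, s, hr, D, hD, hk, S, hS, hsol⟩ :=
      RAM.wp_solveTree (lam := lam) (β := β) (t := t) hG hadj hn hΔ hb hlen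
    refine ⟨k, s, S, hr, ?_, hS, hsol⟩
    have hn1 : Nontrivial (Fin n) := Fin.nontrivial_iff_two_le.2 hn
    have hΔ1 : 1 ≤ G.maxDegree :=
      (hG.connected.preconnected.degree_pos_of_nontrivial ⟨0, by omega⟩).trans_le
        (G.degree_le_maxDegree _)
    have hΔn : G.maxDegree ≤ n := by
      have : Nonempty (Fin n) := ⟨⟨0, by omega⟩⟩
      simpa using G.maxDegree_lt_card_verts.le
    exact (RAM.time_le hn hΔ1 hΔn hl hβ hD hk).trans (Nat.mul_le_mul_left _ (Nat.le_succ _))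
  · have hn1 : n = 1 := by omega
    subst hn1
    obtain ⟨k, s, hr, hk, hm⟩ : RAM.Wp RAM.solveTree
        (RAM.initial (encodeInstance lam β t adj)) fun k s => k ≤ 5 ∧ s.mem 0 = 1 := by
      have m0 : (RAM.initial (encodeInstance lam β t adj)).mem 0 = 1 := rfl
      have r0 : (RAM.initial (encodeInstance lam β t adj)).reg 0 = 0 := rfl
      simp [RAM.solveTree, m0, r0]
    refine ⟨k, s, Finset.univ, hr, by omega, fun v => ?_, by simpa using hβ, fun S' _ => ?_⟩
    · rw [Fin.val_eq_zero v, hm, if_pos (Finset.mem_univ v)]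
    · refine Finset.card_le_card ((Finset.subset_univ _).trans ?_)
      exact influenced_mono (G := G) (t := t) Finset.univ (Nat.zero_le lam)
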